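/- **Setting.** Let $\mathcal X$ be a measurable space, $\mathcal H\subseteq[0,1]^{\mathcal X}$, and let $\ell(a,b)=|a-b|$ be the absolute loss. *One-inclusion graph and its dimension.* For $V\subseteq[0,1]^{n}$, $i\in[n]$ and $f:[n]\setminus\{i\}\to[0,1]$ let $e_{i,f}=\{v\in V: v_j=f_j\ \forall j\ne i\}$. The one-inclusion hypergraph of $V$ has vertex set $V$, and its edges are the nonempty sets $e_{i,f}$. An orientation $\sigma$ picks a vertex $\sigma(e)\in e$ in every edge $e$, and $\mathrm{outdeg}(v;\sigma,\gamma)=|\{i:\ |\sigma(e_{i,v})_i-v_i|>\gamma\}|$. The dimension $\mathbb D^{\mathrm{OIG}}_\gamma(\mathcal H)\in\mathbb N\cup\{\infty\}$ is the supremum of all $n$ for which there are $S\in\mathcal X^n$ and a finite $V\subseteq\mathcal H|_S=\{(h(S_1),\dots,h(S_n)):h\in\mathcal H\}$ such that every orientation $\sigma$ of the one-inclusion hypergraph of $V$ has a vertex $v\in V$ with $\mathrm{outdeg}(v;\sigma,\gamma)>n/3$. *Learning.* A learner $A$ maps every finite labelled sample to a predictor $\mathcal X\to[0,1]$. For a target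 $h^\star\in\mathcal H$ and a probability measure $\mathcal D_{\mathcal X}$ on $\mathcal X$, a sample $S$ of size $m$ consists of $m$ i.i.d. points from $\mathcal D_{\mathcal X}$, labelled by $h^\star$. The cut-off sample complexity $\mathcal M(\mathcal H;\varepsilon,\delta,\gamma)\in\mathbb N\cup\{\infty\}$ is the infimum over all learners $A$ of the least $N$ such that for all $m\ge N$, all $\mathcal D_{\mathcal X}$ and all $h^\star\in\mathcal H$, with probability at least $1-\delta$ over samples $S$ of size $m$, $\Pr_{x\sim\mathcal D_{\mathcal X}}[|A(S;x)-h^\star(x)|>\gamma]\le\varepsilon$. The class $\mathcal H$ is PAC learnable if there is a learner $A$ such that for all $\varepsilon,\delta\in(0,1)$ there is $n$ such that for all $h^\star\in\mathcal H$ and all $\mathcal D_{\mathcal X}$, $\mathbb E_{x\sim\mathcal D_{\mathcal X}}|A(S;x)-h^\star(x)|\le\varepsilon$ with probability at least $1-\delta$ over samples of size $n$. It is cut-off PAC learnable if there is a learner $A$ such that for all $\varepsilon,\delta,\gamma\in(0,1)$ there is $n$ such that the same holds with $\Pr_{x\sim\mathcal D_{\mathcal X}}[|A(S;x)-h^\star(x)|>\gamma]\le\varepsilon$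 in place of the bound on the expectation. Probabilities of non-measurable events are outer probabilities; a bound on an expected loss includes that the loss is measurable for the completion of $\mathcal D_{\mathcal X}$. *Admissibility.* For $S\in\mathcal X^n$, a rule on $S$ of error at most $k$ at scale $\gamma$ is a family of functions $p_i:[0,1]^n\to[0,1]$, $i\in[n]$, where $p_i(y)$ does not depend on $y_i$, such that $|\{i: |p_i(h(S_1),\dots,h(S_n))-h(S_i)|>\gamma\}|\le k$ for every $h\in\mathcal H$. The class $\mathcal H$ is admissible if all $h\in\mathcal H$ are universally measurable and, for all $n,k\in\mathbb N$ and $\gamma\ge0$ such that every $S\in\mathcal X^n$ has a rule of error at most $k$ at scale $\gamma$, such rules $p^S$ can be chosen with $S\mapsto p^S_i(h(S_1),\dots,h(S_n))$ universally measurable for all $h\in\mathcal H$ and $i\in[n]$. (If $\mathcal X$ is countable and its points are measurable, every class is admissible.) **Theorem.** 1. There is a universal constant $c>0$ such that for every $\mathcal X$, every $\mathcal H\subseteq[0,1]^{\mathcal X}$, all $\varepsilon,\delta\in(0,c]$ and all $\gamma\in(0,1)$ with $\mathbb D^{\mathrm{OIG}}_{2\gamma}(\mathcal H)\ge2$, $$\mathcal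 M(\mathcal H;\varepsilon,\delta,\gamma)\ \ge\ c\,\frac{\mathbb D^{\mathrm{OIG}}_{2\gamma}(\mathcal H)}{\varepsilon}.$$ 2. There is a universal constant $C>0$ such that for every $\mathcal X$ and every admissible $\mathcal H\subseteq[0,1]^{\mathcal X}$: (a) for all $\varepsilon,\delta,\gamma\in(0,1)$ for which $d=\mathbb D^{\mathrm{OIG}}_{\gamma}(\mathcal H)$ is finite, $$\mathcal M(\mathcal H;\varepsilon,\delta,\gamma)\ \le\ C\left(\frac{d}{\varepsilon}\log^2\frac{2d}{\varepsilon}+\frac1\varepsilon\log\frac1\delta\right),$$ where the first summand is $0$ if $d=0$; (b) there is a learner $A$ such that for all $n\ge1$, $\delta\in(0,1)$, $h^\star\in\mathcal H$ and $\mathcal D_{\mathcal X}$, with probability at least $1-\delta$ over samples $S$ of size $n$, $$\mathbb E_{x\sim\mathcal D_{\mathcal X}}|A(S;x)-h^\star(x)|\ \le\ \inf_{\gamma\in[0,1]}\left(\gamma+C\,\frac{\mathbb D^{\mathrm{OIG}}_\gamma(\mathcal H)\log^2(n+1)+\log(1/\delta)}{n}\right).$$ 3. An admissible class $\mathcal H\subseteq[0,1]^{\mathcal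 X}$ is PAC learnable if and only if $\mathbb D^{\mathrm{OIG}}_\gamma(\mathcal H)<\infty$ for all $\gamma\in(0,1)$, and it is cut-off PAC learnable if and only if the same condition holds. -/

import Mathlib

open MeasureTheory
open scoped ENNReal

universe u

noncomputable section

namespace OIG

/-! ### The one-inclusion hypergraph and its scaled dimension -/

/-- The projection `H|_S` of a class `H ⊆ [0,1]^X` to a sequence `S` of `n` points. -/
def proj {X : Type u} (H : Set (X → unitInterval)) {n : ℕ} (S : Fin n → X) :
    Set (Fin n → unitInterval) :=
  {v | ∃ h ∈ H, v = fun i => h (S i)}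

/-- The hyperedge `e_{i,f}` of the one-inclusion hypergraph with vertex set `V`: all vertices that
agree with `f` in every coordinate other than `i` (the `i`-th entry of `f` plays no role). -/
def edge {n : ℕ} (V : Set (Fin n → unitInterval)) (i : Fin n) (f : Fin n → unitInterval) :
    Set (Fin n → unitInterval) :=
  {v | v ∈ V ∧ ∀ j, j ≠ i → v j = f j}

/-- The edge set of the one-inclusion hypergraph with vertex set `V`: the nonempty `e_{i,f}`. -/
def edges {n : ℕ} (V : Set (Fin n → unitInterval)) : Set (Set (Fin n → unitInterval)) :=
  {e | e.Nonempty ∧ ∃ i f, e = edge V i f}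

/-- An orientation picks a vertex in every edge (values off the edge set are irrelevant). -/
def IsOrientation {n : ℕ} (V : Set (Fin n → unitInterval))
    (σ : Set (Fin n → unitInterval) → (Fin n → unitInterval)) : Prop :=
  ∀ e ∈ edges V, σ e ∈ e

open Classical in
/-- The scaled out-degree of the vertex `v`:
the number of directions `i` with `|σ_i(e_{i,v}) - v_i| > γ`. -/
def outdeg {n : ℕ} (V : Set (Fin n → unitInterval))
    (σ : Set (Fin n → unitInterval) → (Fin n → unitInterval)) (γ : ℝ)
    (v : Fin n → unitInterval) : ℕ :=
  (Finset.univ.filter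
    (fun i : Fin n => γ < |((σ (edge V i v) i : unitInterval) : ℝ) - (v i : ℝ)|)).card

/-- The `γ`-one-inclusion-graph dimension. A finite subgraph is the hypergraph induced on a finite
set `V` of vertices of the one-inclusion hypergraph of `H|_S` (its edges are the nonempty traces
on `V` of the edges of the big hypergraph; leaving out edges could only lower out-degrees). -/
def dim {X : Type u} (H : Set (X → unitInterval)) (γ : ℝ) : ℕ∞ :=
  ⨆ n ∈ {n : ℕ | ∃ S : Fin n → X, ∃ V : Set (Fin n → unitInterval), V.Finite ∧ V ⊆ proj H S ∧
    ∀ σ, IsOrientation V σ → ∃ v ∈ V, (n : ℝ) / 3 < (outdeg V σ γ v : ℝ)}, (n : ℕ∞)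

/-! ### Learners, losses and sample complexity -/

/-- A (deterministic, possibly improper) learning algorithm: it maps every labelled sample, of any
size `m`, to a predictor. -/
abbrev Learner (X : Type u) : Type u :=
  (m : ℕ) → (Fin m → X × unitInterval) → X → unitInterval

/-- The sample `S` labelled by the target `h`. -/
def labelled {X : Type u} (h : X → unitInterval) {m : ℕ} (S : Fin m → X) :
    Fin m → X × unitInterval :=
  fun i => (S i, h (S i))

/-- The law of an i.i.d. sample of size `m` drawn from `D`. -/
def iid {X : Type u} [MeasurableSpace X] (D : Measure X) [IsProbabilityMeasure D] (m : ℕ) :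
    Measure (Fin m → X) :=
  Measure.pi fun _ => D

/-- `Pr_{x ∼ D}[|f(x) - h(x)| > γ] ≤ ε` (as an outer probability if the event is not
measurable). -/
def CutoffLossLE {X : Type u} [MeasurableSpace X] (D : Measure X) (γ : ℝ)
    (f h : X → unitInterval) (ε : ℝ≥0∞) : Prop :=
  D {x | γ < |(f x : ℝ) - (h x : ℝ)|} ≤ ε

/-- `E_{x ∼ D}[|f(x) - h(x)|] ≤ b`, the loss being measurable so that the expectation exists. -/
def ExpLossLE {X : Type u} [MeasurableSpace X] (D : Measure X)
    (f h : X → unitInterval) (b : ℝ≥0∞) : Prop :=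
  AEMeasurable (fun x => |(f x : ℝ) - (h x : ℝ)|) D ∧
    ∫⁻ x, ENNReal.ofReal |(f x : ℝ) - (h x : ℝ)| ∂D ≤ b

/-- From samples of size `m`, for every target in `H` and every distribution, the cut-off loss of
`A` at scale `γ` is at most `ε` with probability at least `1 - δ`. -/
def CutoffSucceeds {X : Type u} [MeasurableSpace X] (H : Set (X → unitInterval)) (A : Learner X)
    (ε δ γ : ℝ) (m : ℕ) : Prop :=
  ∀ h ∈ H, ∀ (D : Measure X) [IsProbabilityMeasure D],
    iid D m {S | ¬ CutoffLossLE D γ (A m (labelled h S)) h (ENNReal.ofReal ε)} ≤ ENNReal.ofReal δ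

/-- From samples of size `m`, for every target in `H` and every distribution, the expected loss of
`A` is at most `b` with probability at least `1 - δ`. -/
def ExpSucceeds {X : Type u} [MeasurableSpace X] (H : Set (X → unitInterval)) (A : Learner X)
    (b : ℝ≥0∞) (δ : ℝ) (m : ℕ) : Prop :=
  ∀ h ∈ H, ∀ (D : Measure X) [IsProbabilityMeasure D],
    iid D m {S | ¬ ExpLossLE D (A m (labelled h S)) h b} ≤ ENNReal.ofReal δ

/-- `𝓜_A(H; ε, δ, γ)`: the least `N` such that `A` succeeds at every sample size `m ≥ N`
(`⊤` if there is none). -/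
def learnerComplexity {X : Type u} [MeasurableSpace X] (H : Set (X → unitInterval))
    (A : Learner X) (ε δ γ : ℝ) : ℕ∞ :=
  ⨅ N ∈ {N : ℕ | ∀ m, N ≤ m → CutoffSucceeds H A ε δ γ m}, (N : ℕ∞)

/-- The realizable PAC cut-off sample complexity `𝓜(H; ε, δ, γ)`. -/
def sampleComplexity {X : Type u} [MeasurableSpace X] (H : Set (X → unitInterval))
    (ε δ γ : ℝ) : ℕ∞ :=
  ⨅ A : Learner X, learnerComplexity H A ε δ γ

/-- Realizable PAC learnability with respect to the absolute loss. -/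
def PACLearnable {X : Type u} [MeasurableSpace X] (H : Set (X → unitInterval)) : Prop :=
  ∃ A : Learner X, ∀ ε δ : ℝ, 0 < ε → ε < 1 → 0 < δ → δ < 1 →
    ∃ n : ℕ, ExpSucceeds H A (ENNReal.ofReal ε) δ n

/-- Realizable PAC learnability with respect to the cut-off losses. -/
def CutoffPACLearnable {X : Type u} [MeasurableSpace X] (H : Set (X → unitInterval)) : Prop :=
  ∃ A : Learner X, ∀ ε δ γ : ℝ, 0 < ε → ε < 1 → 0 < δ → δ < 1 → 0 < γ → γ < 1 →
    ∃ n : ℕ, CutoffSucceeds H A ε δ γ n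

/-! ### Measure-theoretic admissibility -/

/-- Measurability with respect to the completion of every probability measure. -/
def UnivMeasurable {Y : Type u} [MeasurableSpace Y] (f : Y → unitInterval) : Prop :=
  ∀ (μ : Measure Y) [IsProbabilityMeasure μ], AEMeasurable f μ

open Classical in
/-- `p` predicts, for every `i`, the label at `S i` from the labels at the other points of `S` (so
`p i y` does not depend on `y i`), and for every target in `H` at most `k` of these predictions
are off by more than `γ`. -/
def IsPredictionRule {X : Type u} (H : Set (X → unitInterval)) {n : ℕ} (S : Fin n → X) (γ : ℝ)
    (k : ℕ) (p : Fin n → (Fin n → unitInterval) → unitInterval) : Prop :=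
  (∀ i y z, (∀ j, j ≠ i → y j = z j) → p i y = p i z) ∧
    ∀ h ∈ H, (Finset.univ.filter
      (fun i : Fin n => γ < |(p i (fun j => h (S j)) : ℝ) - (h (S i) : ℝ)|)).card ≤ k

/-- Admissible classes: the hypotheses are universally measurable, and prediction rules that exist
for every single sequence of points can be chosen so that, for every fixed target, the prediction
is a universally measurable function of the sequence. -/
def Admissible {X : Type u} [MeasurableSpace X] (H : Set (X → unitInterval)) : Prop :=
  (∀ h ∈ H, UnivMeasurable h) ∧
    ∀ (n k : ℕ) (γ : ℝ), 0 ≤ γ → (∀ S : Fin n → X, ∃ p, IsPredictionRule H S γ k p) →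
      ∃ P : (Fin n → X) → Fin n → (Fin n → unitInterval) → unitInterval,
        (∀ S, IsPredictionRule H S γ k (P S)) ∧
          ∀ h ∈ H, ∀ i, UnivMeasurable fun S : Fin n → X => P S i (fun j => h (S j))

/-- On a countable instance space with measurable points every class is admissible. -/
theorem admissible_of_countable {X : Type u} [MeasurableSpace X] [Countable X]
    [MeasurableSingletonClass X] (H : Set (X → unitInterval)) : Admissible H := by
  refine ⟨fun h _ μ _ => (measurable_of_countable h).aemeasurable, fun n k γ _ hp => ?_⟩
  choose P hP using hp
  exact ⟨P, hP, fun h _ i μ _ => (measurable_of_countable _).aemeasurable⟩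

end OIG

end

/-!
Lower bound. A learner orients the one-inclusion hypergraph of a finite `V ⊆ H|_S`: the edge in
direction `i` through `v` points to the vertex whose `i`-th label the learner is most likely to
predict within `γ` when the sample misses the `i`-th point, since such a sample does not tell the
vertices of the edge apart (`exists_orientation_of_learner`). Where the orientation moves `v` by more
than `2 * γ`, the learner errs on `v` with conditional probability at least `1/2`. A witness of the
dimension has a vertex `v` with more than `n / 3` such directions. Under the distribution with mass
`48 * ε` spread over all points but one heavy one, fewer than about `n / ε` examples miss each light
point with probability at least `1/2`, and a first-moment argument shows that the learner fails on
`v` (`not_cutoffSucceeds_of_forall_orientation`).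

Upper bound. If the dimension at scale `γ` is at most `d`, all finite subgraphs on `d + 1` points have
orientations with out-degrees at most `(d + 1) / 3`, and by compactness every `(d + 1)`-tuple of
points has a prediction rule with at most a third of its predictions off by more than `γ`
(`exists_isPredictionRule`). By exchangeability, for every weighting of a labelled sample some tuple
of sample points gives a predictor of relative error at most `1/3` (`exists_weakPredict`).
Multiplicative weights combine `T = O(log m)` of these into a family whose majority, hence whose
median, is within `γ` of every label (`exists_boost_majority`, `abs_median_sub_le`). The median
depends on at most `T * (d + 1) = O(d * log m)` sample points, so it generalizes: the points outside
are independent of it, and there are only `(m ^ (d + 1) * (d + 1)) ^ T` choices of such a median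
(`measure_vote_consistent_le`, `measure_boostLearner_fail_le`). Admissibility makes the error set
null-measurable on the product of the compressed sample and a fresh point, which the independence
argument needs, and makes the loss of almost every resulting predictor measurable.

For the bound on the expected loss, the scale and dimension that minimize the trade-off depend on
the sample size and the class alone, so one learner can use the optimal scale for each size. The
minimum is attained because the dimension is right-continuous in the scale (`dim_le_of_forall_gt`,
`exists_optimal_scale`). The characterization of learnability combines both bounds with Markov's
inequality.
-/

namespace OIG

/-! ### Edges and orientations -/

section Graph

variable {n : ℕ} {V : Set (Fin n → unitInterval)} {i : Fin n} {f g v : Fin n → unitInterval}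

lemma mem_edge_self (hv : v ∈ V) : v ∈ edge V i v := ⟨hv, fun _ _ => rfl⟩

lemma edge_congr (h : ∀ j, j ≠ i → f j = g j) : edge V i f = edge V i g := by
  ext v
  refine and_congr_right fun _ => forall₂_congr fun j hj => by rw [h j hj]

lemma edge_mem_edges (hv : v ∈ V) : edge V i v ∈ edges V :=
  ⟨⟨v, mem_edge_self hv⟩, i, v, rfl⟩

lemma exists_isOrientation (V : Set (Fin n → unitInterval)) : ∃ σ, IsOrientation V σ := by
  classical
  refine ⟨fun e => if h : e.Nonempty then h.some else fun _ => 0, fun e he => ?_⟩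
  simp only [dif_pos he.1]
  exact he.1.some_mem

/-- Two vertices of a common edge that differ in coordinate `i` determine its direction. A set of
vertices can be `edge V i f` for several `i`, but only if it is a singleton. -/
lemma direction_unique {u w : Fin n → unitInterval} {i' : Fin n}
    (hu : u ∈ edge V i' f) (hw : w ∈ edge V i' f) (hne : u i ≠ w i) : i' = i := by
  by_contra h
  exact hne ((hu.2 i (Ne.symm h)).trans (hw.2 i (Ne.symm h)).symm)

end Graph

/-! ### The lower bound -/

section LowerBound

variable {X : Type u} {n m : ℕ}

/-- Every learner induces an orientation: each edge points to the vertex on which the learner is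
most likely to be right, among samples of positions that miss the direction of the edge. If the
orientation moves `v` by more than `2 * γ` in direction `i`, then `v` and the vertex pointed to
cannot both be predicted within `γ`, so the learner errs on `v` with conditional probability at
least `1/2` when `i` is missed. -/
lemma exists_orientation_of_learner (Q : Measure (Fin m → Fin n)) [IsProbabilityMeasure Q]
    (S : Fin n → X) (A : (Fin m → X × unitInterval) → X → unitInterval) {γ : ℝ}
    (hγ : 0 ≤ γ) (V : Set (Fin n → unitInterval)) (hV : V.Finite) :
    ∃ σ, IsOrientation V σ ∧ ∀ v ∈ V, ∀ i : Fin n,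
      2 * γ < |((σ (edge V i v) i : unitInterval) : ℝ) - (v i : ℝ)| →
      Q.real {T | ∀ k, T k ≠ i} ≤ 2 * Q.real {T | (∀ k, T k ≠ i) ∧
        γ < |(A (fun k => (S (T k), v (T k))) (S i) : ℝ) - (v i : ℝ)|} := by
  classical
  set B : Fin n → (Fin n → unitInterval) → unitInterval → ℝ := fun i f u =>
    Q.real {T | (∀ k, T k ≠ i) ∧
      |(A (fun k => (S (T k), f (T k))) (S i) : ℝ) - (u : ℝ)| ≤ γ} with hB
  have hBcongr : ∀ i f g, (∀ j, j ≠ i → f j = g j) → ∀ u, B i f u = B i g u := by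
    intro i f g hfg u
    simp only [hB]
    congr 1
    ext T
    refine and_congr_right fun hT => ?_
    have : (fun k => (S (T k), f (T k))) = fun k => (S (T k), g (T k)) := by
      funext k
      rw [hfg _ (hT k)]
    rw [this]
  have hex : ∀ e ∈ edges V, ∃ w ∈ e, ∃ i f, e = edge V i f ∧ ∀ w' ∈ e, B i f (w' i) ≤ B i f (w i) := by
    rintro e ⟨hne, i, f, rfl⟩
    obtain ⟨w, hw, hmax⟩ := Set.exists_max_image (edge V i f) (fun w => B i f (w i))
      (hV.subset fun w hw => hw.1) hne
    exact ⟨w, hw, i, f, rfl, hmax⟩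
  choose! σ hσ hσ' using hex
  refine ⟨σ, hσ, fun v hv i hi => ?_⟩
  obtain ⟨i', f', he, hmax⟩ := hσ' _ (edge_mem_edges (i := i) hv)
  have hmem := hσ _ (edge_mem_edges (i := i) hv)
  have hne : σ (edge V i v) i ≠ v i := by
    intro h
    simp only [h, sub_self, abs_zero] at hi
    linarith
  have hvi : v ∈ edge V i' f' := he ▸ mem_edge_self hv
  have hii : i' = i := direction_unique (he ▸ hmem) hvi hne
  subst hii
  have hcmp := hmax v (mem_edge_self hv)
  rw [hBcongr i' f' v (fun j hj => (hvi.2 j hj).symm), hBcongr i' f' v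
    (fun j hj => (hvi.2 j hj).symm)] at hcmp
  set w := σ (edge V i' v)
  have hdisj : B i' v (v i') + B i' v (w i') ≤ Q.real {T | ∀ k, T k ≠ i'} := by
    simp only [hB]
    rw [← measureReal_union _ (Set.toFinite _).measurableSet]
    · exact measureReal_mono (Set.union_subset (fun T h => h.1) (fun T h => h.1))
    · rw [Set.disjoint_left]
      rintro T ⟨-, h1⟩ ⟨-, h2⟩
      have := abs_sub_le (w i' : ℝ) (A (fun k => (S (T k), v (T k))) (S i') : ℝ) (v i' : ℝ)
      rw [abs_sub_comm] at h2
      linarith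
  have hcover : Q.real {T | ∀ k, T k ≠ i'} ≤ B i' v (v i') + Q.real {T | (∀ k, T k ≠ i') ∧
        γ < |(A (fun k => (S (T k), v (T k))) (S i') : ℝ) - (v i' : ℝ)|} := by
    refine le_trans (measureReal_mono ?_) (measureReal_union_le _ _)
    intro T hT
    rcases le_or_gt (|(A (fun k => (S (T k), v (T k))) (S i') : ℝ) - (v i' : ℝ)|) γ with h | h
    · exact Or.inl ⟨hT, h⟩
    · exact Or.inr ⟨hT, h⟩
  linarith

/-- If no outcome lies in more than `c` of the events, their probabilities sum to at most `c`. -/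
lemma sum_measureReal_le_of_card_le {Ω ι : Type*} [MeasurableSpace Ω] [Fintype Ω]
    [MeasurableSingletonClass Ω] (Q : Measure Ω) [IsProbabilityMeasure Q] (I : Finset ι)
    (E : ι → Set Ω) [∀ i, DecidablePred (· ∈ E i)] (c : ℝ)
    (h : ∀ ω, ((I.filter fun i => ω ∈ E i).card : ℝ) ≤ c) : ∑ i ∈ I, Q.real (E i) ≤ c := by
  classical
  have h1 : ∀ i, Q.real (E i) = ∑ ω, if ω ∈ E i then Q.real {ω} else 0 := by
    intro i
    rw [← Finset.sum_filter, sum_measureReal_singleton]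
    congr 1
    ext ω
    simp
  calc ∑ i ∈ I, Q.real (E i) = ∑ ω, ((I.filter fun i => ω ∈ E i).card : ℝ) * Q.real {ω} := by
        simp_rw [h1]
        rw [Finset.sum_comm]
        refine Finset.sum_congr rfl fun ω _ => ?_
        rw [← Finset.sum_filter, Finset.sum_const, nsmul_eq_mul]
    _ ≤ ∑ ω, c * Q.real {ω} := Finset.sum_le_sum fun ω _ =>
        mul_le_mul_of_nonneg_right (h ω) measureReal_nonneg
    _ = c := by
        rw [← Finset.mul_sum, sum_measureReal_singleton]
        simp

/-- The measure on `Fin n` with weights `p`; negative weights count as `0`. -/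
noncomputable def discrete (p : Fin n → ℝ) : Measure (Fin n) :=
  ∑ i, ENNReal.ofReal (p i) • Measure.dirac i

lemma discrete_apply (p : Fin n → ℝ) (hp : ∀ i, 0 ≤ p i) (s : Set (Fin n)) [DecidablePred (· ∈ s)] :
    discrete p s = ENNReal.ofReal (∑ i with i ∈ s, p i) := by
  rw [discrete, Measure.finsetSum_apply, ENNReal.ofReal_sum_of_nonneg fun i _ => hp i,
    Finset.sum_filter]
  refine Finset.sum_congr rfl fun i _ => ?_
  by_cases h : i ∈ s <;> simp [h]

/-- If every orientation of a finite `V` has a vertex with at least `(n - 1) / 6` large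
displacements away from a fixed heavy coordinate `i₀`, no learner succeeds from
`m ≤ (n - 1) / (96 * ε)` examples. -/
lemma not_cutoffSucceeds_of_forall_orientation [MeasurableSpace X] (H : Set (X → unitInterval))
    (S : Fin n → X) (V : Set (Fin n → unitInterval)) (hVf : V.Finite) (hV : V ⊆ proj H S)
    (i₀ : Fin n) (hn : 2 ≤ n) {ε δ γ : ℝ} (hγ : 0 < γ)
    (hσ : ∀ σ, IsOrientation V σ → ∃ v ∈ V, ∃ I : Finset (Fin n), i₀ ∉ I ∧
      ((n : ℝ) - 1) / 6 ≤ I.card ∧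
      ∀ i ∈ I, 2 * γ < |((σ (edge V i v) i : unitInterval) : ℝ) - (v i : ℝ)|)
    (hε : 0 < ε) (hε' : ε ≤ 1 / 48) (hδ : δ < 1 / 8) (A : Learner X)
    (hm : (m : ℝ) * (96 * ε) ≤ (n : ℝ) - 1) : ¬ CutoffSucceeds H A ε δ γ m := by
  classical
  intro hsucc
  have hn' : (2 : ℝ) ≤ n := by exact_mod_cast hn
  have hN : (0 : ℝ) < (n : ℝ) - 1 := by linarith
  -- The heavy coordinate carries mass `1 - 48 * ε`; the others share `48 * ε` evenly.
  -- A learner wrong on more than an eighth of at least `(n - 1) / 6` light coordinates has loss above `ε`.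
  set r : ℝ := 48 * ε / ((n : ℝ) - 1) with hr
  have hr0 : 0 < r := by positivity
  have hrN : r * ((n : ℝ) - 1) = 48 * ε := by rw [hr]; field_simp
  set p : Fin n → ℝ := fun i => if i = i₀ then 1 - 48 * ε else r with hp
  have hp0 : ∀ i, 0 ≤ p i := by
    intro i
    simp only [hp]
    split_ifs <;> linarith
  have hpsum : ∑ i, p i = 1 := by
    rw [← Finset.add_sum_erase _ _ (Finset.mem_univ i₀)]
    have h1 : ∑ i ∈ Finset.univ.erase i₀, p i = ∑ i ∈ Finset.univ.erase i₀, r :=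
      Finset.sum_congr rfl fun i hi => by simp [hp, Finset.ne_of_mem_erase hi]
    have h2 : (((n - 1 : ℕ)) : ℝ) = (n : ℝ) - 1 := by
      rw [Nat.cast_sub (by omega)]; simp
    rw [h1, Finset.sum_const, Finset.card_erase_of_mem (Finset.mem_univ _), nsmul_eq_mul,
      Finset.card_univ, Fintype.card_fin, h2, mul_comm, hrN]
    simp [hp]
  set ν := discrete p with hνdef
  have : IsProbabilityMeasure ν := ⟨by
    rw [hνdef, discrete_apply p hp0]
    simp [hpsum]⟩
  have hSm : Measurable S := Measurable.of_discrete
  set D : Measure X := ν.map S with hD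
  have : IsProbabilityMeasure D := Measure.isProbabilityMeasure_map hSm.aemeasurable
  set Q : Measure (Fin m → Fin n) := Measure.pi fun _ => ν with hQ
  have hiid : iid D m = Q.map fun T k => S (T k) := by
    rw [iid, hQ, hD]
    exact (Measure.pi_map_pi (μ := fun _ : Fin m => ν) (f := fun _ => S)
      fun _ => hSm.aemeasurable).symm
  -- A fixed light coordinate is missed with probability at least `1/2`.
  have hmiss : ∀ i, i ≠ i₀ → 1 / 2 ≤ Q.real {T | ∀ k, T k ≠ i} := by
    intro i hi
    have h1 : {T : Fin m → Fin n | ∀ k, T k ≠ i} = Set.univ.pi fun _ => {i}ᶜ := by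
      ext T; simp
    have h2 : ν.real {i}ᶜ = 1 - r := by
      rw [measureReal_compl (Set.toFinite _).measurableSet]
      have : ν.real {i} = r := by
        rw [measureReal_def, hνdef, discrete_apply p hp0]
        simp [Finset.filter_eq', hp, hi, hr0.le]
      simp [this]
    have h3 : Q.real {T | ∀ k, T k ≠ i} = (1 - r) ^ m := by
      rw [h1, measureReal_def, hQ, Measure.pi_pi, ENNReal.toReal_prod]
      simp [← measureReal_def, h2]
    rw [h3]
    have hr1 : r ≤ 1 := by
      rw [hr, div_le_one hN]; linarith
    have h4 := one_add_mul_le_pow (a := -r) (by linarith) m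
    have h5 : (m : ℝ) * r ≤ 1 / 2 := by
      rw [hr, ← mul_div_assoc, div_le_iff₀ hN]
      linarith
    have h6 : (1 + -r) ^ m = (1 - r) ^ m := by rw [sub_eq_add_neg]
    rw [h6] at h4
    linarith
  obtain ⟨σ, hσo, hσe⟩ := exists_orientation_of_learner Q S (A m) hγ.le V hVf
  obtain ⟨v, hv, I, hi₀, hIcard, hI⟩ := hσ σ hσo
  obtain ⟨h, hh, hvh⟩ := hV hv
  have hvh' : ∀ i, v i = h (S i) := fun i => by rw [hvh]
  have hIpos : (0 : ℝ) < I.card := lt_of_lt_of_le (by linarith) hIcard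
  set F : Set (Fin m → Fin n) := {T | ¬ CutoffLossLE D γ (A m (labelled h fun k => S (T k))) h
    (ENNReal.ofReal ε)} with hF
  have hFle : Q.real F ≤ max δ 0 := by
    have h1 : Q F ≤ ENNReal.ofReal δ := by
      refine le_trans ?_ (hsucc h hh D)
      rw [hiid]
      exact Measure.le_map_apply (Measurable.of_discrete).aemeasurable _
    rw [measureReal_def]
    refine le_trans (ENNReal.toReal_mono ENNReal.ofReal_ne_top h1) ?_
    rw [ENNReal.toReal_ofReal']
  set W : Fin n → Set (Fin m → Fin n) := fun i => {T | (∀ k, T k ≠ i) ∧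
        γ < |(A m (fun k => (S (T k), v (T k))) (S i) : ℝ) - (v i : ℝ)|} with hW
  have hWlow : ∀ i ∈ I, 1 / 4 ≤ Q.real (W i) := by
    intro i hi
    have h1 := hσe v hv i (hI i hi)
    have h2 := hmiss i (by rintro rfl; exact hi₀ hi)
    linarith
  -- Outside `F` few light coordinates are predicted wrongly.
  have hcount : ∀ T, ((I.filter fun i => T ∈ W i \ F).card : ℝ) ≤ I.card / 8 := by
    intro T
    by_cases hT : T ∈ F
    · simp only [Set.mem_sdiff, hT, not_true_eq_false, and_false, Finset.filter_false,
        Finset.card_empty, Nat.cast_zero]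
      positivity
    have hloss : CutoffLossLE D γ (A m (labelled h fun k => S (T k))) h (ENNReal.ofReal ε) := by
      by_contra hc
      exact hT hc
    have h1 : ν (S ⁻¹' {x | γ < |(A m (labelled h fun k => S (T k)) x : ℝ) - (h x : ℝ)|}) ≤
        ENNReal.ofReal ε :=
      (Measure.le_map_apply hSm.aemeasurable _).trans hloss
    rw [hνdef, discrete_apply p hp0, ENNReal.ofReal_le_ofReal_iff hε.le] at h1
    have h2 : ((I.filter fun i => T ∈ W i \ F).card : ℝ) * r ≤ ε := by
      refine le_trans ?_ h1
      rw [← nsmul_eq_mul, ← Finset.sum_const]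
      have h3 : ∑ i ∈ I.filter (fun i => T ∈ W i \ F), r =
          ∑ i ∈ I.filter (fun i => T ∈ W i \ F), p i := by
        refine Finset.sum_congr rfl fun i hi => ?_
        have : i ≠ i₀ := by
          rintro rfl
          exact hi₀ (Finset.mem_filter.1 hi).1
        simp [hp, this]
      rw [h3]
      refine Finset.sum_le_sum_of_subset_of_nonneg ?_ fun i _ _ => hp0 i
      intro i hi
      have hi' := (Finset.mem_filter.1 hi).2.1.2
      simp only [hvh'] at hi'
      exact Finset.mem_filter.2 ⟨Finset.mem_univ _, hi'⟩
    have h4 : ((I.filter fun i => T ∈ W i \ F).card : ℝ) * (48 * ε) ≤ ε * ((n : ℝ) - 1) := by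
      rw [← hrN, ← mul_assoc]
      exact mul_le_mul_of_nonneg_right h2 hN.le
    have h5 : ((I.filter fun i => T ∈ W i \ F).card : ℝ) * 48 ≤ (n : ℝ) - 1 := by
      refine le_of_mul_le_mul_right ?_ hε
      linarith
    linarith
  have hsum := sum_measureReal_le_of_card_le Q I (fun i => W i \ F) _ hcount
  have hsplit : ∀ i ∈ I, 1 / 4 ≤ Q.real (W i \ F) + Q.real F := by
    intro i hi
    refine (hWlow i hi).trans (le_trans (measureReal_mono ?_) (measureReal_union_le _ _))
    intro T hT
    by_cases h : T ∈ F
    · exact Or.inr h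
    · exact Or.inl ⟨hT, h⟩
  have htot := Finset.sum_le_sum hsplit
  rw [Finset.sum_add_distrib, Finset.sum_const, Finset.sum_const, nsmul_eq_mul,
    nsmul_eq_mul] at htot
  have hFlt : Q.real F < 1 / 8 := hFle.trans_lt (max_lt hδ (by norm_num))
  nlinarith

/-- A scale-`2 * γ` witness of size `n ≥ 2` for the dimension rules out learning at scale `γ` from
`n / (192 * ε)` examples. -/
lemma not_cutoffSucceeds_of_witness [MeasurableSpace X] (H : Set (X → unitInterval)) (hn : 2 ≤ n)
    (S : Fin n → X) (V : Set (Fin n → unitInterval)) (hVf : V.Finite) (hV : V ⊆ proj H S)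
    {ε δ γ : ℝ} (hγ : 0 < γ)
    (hσ : ∀ σ, IsOrientation V σ → ∃ v ∈ V, (n : ℝ) / 3 < (outdeg V σ (2 * γ) v : ℝ))
    (hε : 0 < ε) (hε' : ε ≤ 1 / 48) (hδ : δ < 1 / 8) (A : Learner X)
    (hm : (m : ℝ) * (192 * ε) ≤ n) : ¬ CutoffSucceeds H A ε δ γ m := by
  classical
  have hn' : (2 : ℝ) ≤ n := by exact_mod_cast hn
  have hm' : (m : ℝ) * (96 * ε) ≤ (n : ℝ) - 1 := by linarith
  rcases hn.eq_or_lt with rfl | h3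
  · -- For `n = 2` the heavy coordinate must be chosen before the orientation: any displacement
    -- comes from two vertices `a`, `b` of a common edge, and these form a witness by themselves.
    obtain ⟨σ, hσo⟩ := exists_isOrientation V
    obtain ⟨a, ha, hout⟩ := hσ σ hσo
    have hpos : 0 < outdeg V σ (2 * γ) a := by
      have : (0 : ℝ) < (outdeg V σ (2 * γ) a : ℝ) := lt_trans (by norm_num) hout
      exact_mod_cast this
    obtain ⟨i, hi⟩ := Finset.card_pos.1 hpos
    replace hi := (Finset.mem_filter.1 hi).2
    set b := σ (edge V i a) with hb
    have hbe : b ∈ edge V i a := hσo _ (edge_mem_edges ha)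
    obtain ⟨i₀, hi₀⟩ : ∃ i₀ : Fin 2, i₀ ≠ i := exists_ne i
    have hedge : ∀ w ∈ ({a, b} : Set (Fin 2 → unitInterval)),
        edge ({a, b} : Set (Fin 2 → unitInterval)) i w = {a, b} := by
      intro w hw
      refine Set.Subset.antisymm (fun z hz => hz.1) fun z hz => ⟨hz, fun j hj => ?_⟩
      have := hbe.2 j hj
      rcases hw with rfl | rfl <;> rcases hz with rfl | rfl <;> simp [this]
    refine not_cutoffSucceeds_of_forall_orientation H S {a, b} (Set.toFinite _) ?_ i₀ le_rfl hγ
      ?_ hε hε' hδ A hm'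
    · rintro w (rfl | rfl)
      · exact hV ha
      · exact hV hbe.1
    · intro τ hτ
      have hmem : τ {a, b} ∈ ({a, b} : Set (Fin 2 → unitInterval)) := by
        have := hτ _ (edge_mem_edges (i := i) (Set.mem_insert a {b}))
        rwa [hedge a (Set.mem_insert a {b})] at this
      rcases hmem with h | h
      · refine ⟨b, by simp, {i}, by simpa using hi₀, by norm_num, fun j hj => ?_⟩
        rw [Finset.mem_singleton.1 hj, hedge b (by simp), h, abs_sub_comm]
        exact hi
      · refine ⟨a, by simp, {i}, by simpa using hi₀, by norm_num, fun j hj => ?_⟩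
        rw [Finset.mem_singleton.1 hj, hedge a (by simp), h]
        exact hi
  · refine not_cutoffSucceeds_of_forall_orientation H S V hVf hV ⟨0, by omega⟩ hn hγ
      ?_ hε hε' hδ A hm'
    intro σ hσo
    obtain ⟨v, hv, hout⟩ := hσ σ hσo
    refine ⟨v, hv, (Finset.univ.filter (fun i : Fin n =>
      2 * γ < |((σ (edge V i v) i : unitInterval) : ℝ) - (v i : ℝ)|)).erase ⟨0, by omega⟩,
      Finset.notMem_erase _ _, ?_, fun i hi => (Finset.mem_filter.1 (Finset.mem_of_mem_erase hi)).2⟩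
    have h1 : outdeg V σ (2 * γ) v - 1 ≤ _ := Finset.pred_card_le_card_erase
      (s := Finset.univ.filter (fun i : Fin n =>
        2 * γ < |((σ (edge V i v) i : unitInterval) : ℝ) - (v i : ℝ)|)) (a := ⟨0, by omega⟩)
    have h2 : n + 1 ≤ 3 * outdeg V σ (2 * γ) v := by
      have : (n : ℝ) < 3 * outdeg V σ (2 * γ) v := by linarith
      exact_mod_cast this
    have h4 : n - 1 ≤ 6 * (outdeg V σ (2 * γ) v - 1) := by omega
    have h5 := h4.trans (Nat.mul_le_mul_left 6 h1)
    have h6 : ((n - 1 : ℕ) : ℝ) ≤ ((6 * _ : ℕ) : ℝ) := Nat.cast_le.2 h5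
    rw [Nat.cast_sub (by omega)] at h6
    push_cast at h6
    linarith

end LowerBound

/-! ### Prediction rules from orientations -/

section Rules

variable {X : Type u} {H : Set (X → unitInterval)} {γ : ℝ}

lemma exists_orientation_of_dim_lt {n : ℕ} (hd : dim H γ < n) (S : Fin n → X)
    {V : Set (Fin n → unitInterval)} (hVf : V.Finite) (hV : V ⊆ proj H S) :
    ∃ σ, IsOrientation V σ ∧ ∀ v ∈ V, outdeg V σ γ v ≤ n / 3 := by
  by_contra! hcon
  refine hd.not_ge (le_iSup₂_of_le n ⟨S, V, hVf, hV, fun σ hσ => ?_⟩ le_rfl)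
  obtain ⟨v, hv, hout⟩ := hcon σ hσ
  refine ⟨v, hv, ?_⟩
  have h1 : n < 3 * outdeg V σ γ v := by omega
  have h2 : (n : ℝ) < 3 * outdeg V σ γ v := by exact_mod_cast h1
  linarith

/-- Beyond the dimension, every sequence of `n` points has a rule with at most `n / 3` errors.
Orientations of finite subgraphs give rules for finitely many targets at a time; the number of
errors on one target is lower semicontinuous in the rule, so compactness of the space of all rules
yields one that serves every target. -/
lemma exists_isPredictionRule {n : ℕ} (hd : dim H γ < n) (S : Fin n → X) :
    ∃ p, IsPredictionRule H S γ (n / 3) p := by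
  classical
  let K : proj H S → Set (Fin n → (Fin n → unitInterval) → unitInterval) := fun v =>
    {p | (Finset.univ.filter fun i : Fin n =>
      γ < |(p i (Function.update v.1 i 0) : ℝ) - (v.1 i : ℝ)|).card ≤ n / 3}
  have hK : ∀ v, IsClosed (K v) := by
    intro v
    have : K v = ⋃ B ∈ (Finset.univ.filter fun B : Finset (Fin n) => B.card ≤ n / 3),
        ⋂ i ∈ Bᶜ, {p : Fin n → (Fin n → unitInterval) → unitInterval |
          |(p i (Function.update v.1 i 0) : ℝ) - (v.1 i : ℝ)| ≤ γ} := by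
      ext p
      simp only [K, Set.mem_ofPred_eq, Set.mem_iUnion, Finset.mem_filter, Finset.mem_univ,
        true_and, Set.mem_iInter, Finset.mem_compl, exists_prop]
      constructor
      · intro h
        exact ⟨_, h, fun i hi => by simpa using hi⟩
      · rintro ⟨B, hB, hp⟩
        refine (Finset.card_le_card fun i hi => ?_).trans hB
        by_contra hiB
        exact (hp i hiB).not_gt (Finset.mem_filter.1 hi).2
    rw [this]
    refine isClosed_biUnion_finset fun B _ => isClosed_biInter fun i _ => ?_
    exact isClosed_le (by fun_prop) continuous_const
  have hfin : ∀ s : Finset (proj H S), (⋂ v ∈ s, K v).Nonempty := by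
    intro s
    obtain ⟨σ, -, hout⟩ := exists_orientation_of_dim_lt hd S
      (V := Subtype.val '' (s : Set (proj H S))) (s.finite_toSet.image _)
      (by rintro _ ⟨v, -, rfl⟩; exact v.2)
    refine ⟨fun i f => σ (edge (Subtype.val '' (s : Set (proj H S))) i f) i, ?_⟩
    simp only [Set.mem_iInter]
    intro v hv
    have := hout v.1 ⟨v, hv, rfl⟩
    simp only [outdeg] at this
    simp only [K, Set.mem_ofPred_eq]
    convert this using 8 with i
    refine edge_congr fun j hj => ?_
    simp [hj]
  obtain ⟨p, hp⟩ := CompactSpace.iInter_nonempty hK hfin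
  refine ⟨fun i y => p i (Function.update y i 0), fun i y z hyz => ?_, fun h hh => ?_⟩
  · have : Function.update y i 0 = Function.update z i 0 := by
      ext j
      by_cases hj : j = i
      · subst hj; simp
      · simp [hj, hyz j hj]
    simp only [this]
  · have h1 := Set.mem_iInter.1 hp ⟨_, h, hh, rfl⟩
    simp only [K, Set.mem_ofPred_eq] at h1
    convert h1

end Rules

/-! ### Medians -/

section Median

open Classical in
/-- The (upper) median of `a 0, …, a (T - 1)`: the largest value that at least half of the entries
attain or exceed. -/
noncomputable def median {T : ℕ} (a : Fin T → unitInterval) : unitInterval :=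
  (Finset.univ.filter fun B : Finset (Fin T) => T ≤ 2 * B.card).sup fun B => B.inf a

open Classical in
lemma abs_median_sub_le {T : ℕ} (a : Fin T → unitInterval) (y : unitInterval) (γ : ℝ)
    (h : 2 * (Finset.univ.filter fun s : Fin T => γ < |(a s : ℝ) - (y : ℝ)|).card < T) :
    |(median a : ℝ) - (y : ℝ)| ≤ γ := by
  set G := Finset.univ.filter fun s : Fin T => ¬ γ < |(a s : ℝ) - (y : ℝ)| with hG
  have hcard : (Finset.univ.filter fun s : Fin T => γ < |(a s : ℝ) - (y : ℝ)|).card + G.card = T := by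
    rw [hG, Finset.card_filter_add_card_filter_not]
    simp
  have hGmem : G ∈ Finset.univ.filter fun B : Finset (Fin T) => T ≤ 2 * B.card := by
    simp only [Finset.mem_filter, Finset.mem_univ, true_and]
    omega
  have hgood : ∀ s ∈ G, |(a s : ℝ) - (y : ℝ)| ≤ γ := fun s hs => not_lt.1 (Finset.mem_filter.1 hs).2
  have hGne : G.Nonempty := Finset.card_pos.1 (by omega)
  rw [abs_le]
  constructor
  · obtain ⟨s, hs, hinf⟩ := Finset.exists_mem_eq_inf G hGne a
    have h1 : a s ≤ median a := hinf ▸ Finset.le_sup (f := fun B : Finset (Fin T) => B.inf a) hGmem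
    have h2 : (a s : ℝ) ≤ median a := h1
    have := (abs_le.1 (hgood s hs)).1
    linarith
  · obtain ⟨B, hB, hsup⟩ := Finset.exists_mem_eq_sup _ ⟨G, hGmem⟩
      (fun B : Finset (Fin T) => B.inf a)
    replace hB := (Finset.mem_filter.1 hB).2
    obtain ⟨s, hs⟩ : (B ∩ G).Nonempty := by
      rw [Finset.nonempty_iff_ne_empty]
      intro hempty
      have h1 := Finset.card_union_add_card_inter B G
      have h2 : (B ∪ G).card ≤ T := by simpa using Finset.card_le_univ (B ∪ G)
      rw [hempty, Finset.card_empty] at h1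
      omega
    have h1 : median a ≤ a s := by
      rw [median, hsup]
      exact Finset.inf_le (Finset.mem_inter.1 hs).1
    have h2 : (median a : ℝ) ≤ a s := h1
    have := (abs_le.1 (hgood s (Finset.mem_inter.1 hs).2)).2
    linarith

lemma continuous_median (T : ℕ) : Continuous (median : (Fin T → unitInterval) → unitInterval) := by
  classical
  exact Continuous.finset_sup_apply fun B _ => Continuous.finset_inf_apply fun i _ =>
    continuous_apply i

end Median

/-! ### Boosting -/

section Boosting

/-- Multiplicative weights: if under all weights some predictor has relative error at most `1/3`,
predictors can be chosen greedily so that the potential, in which each error doubles the weight of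
a point, grows by a factor of at most `4/3` per step. -/
lemma exists_boost {ι G : Type*} [Fintype ι] (wrong : G → ι → Prop)
    [∀ g, DecidablePred (wrong g)]
    (hweak : ∀ w : ι → ℝ, (∀ j, 0 ≤ w j) → ∃ g, 3 * ∑ j with wrong g j, w j ≤ ∑ j, w j) (T : ℕ) :
    ∃ g : Fin T → G, ∑ j, (2 : ℝ) ^ (Finset.univ.filter fun s => wrong (g s) j).card ≤
      Fintype.card ι * (4 / 3) ^ T := by
  induction T with
  | zero => exact ⟨Fin.elim0, by simp⟩
  | succ T ih =>
    obtain ⟨g, hg⟩ := ih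
    set w : ι → ℝ := fun j => (2 : ℝ) ^ (Finset.univ.filter fun s => wrong (g s) j).card with hw
    obtain ⟨g₀, hg₀⟩ := hweak w fun j => by positivity
    refine ⟨Fin.cons g₀ g, ?_⟩
    have hstep : ∀ j, (2 : ℝ) ^ (Finset.univ.filter fun s =>
        wrong ((Fin.cons g₀ g : Fin (T + 1) → G) s) j).card =
        w j + if wrong g₀ j then w j else 0 := by
      intro j
      rw [Fin.card_filter_univ_succ']
      simp only [Fin.cons_zero, Fin.cons_succ, hw]
      split_ifs
      · rw [pow_add]; ring
      · simp
    rw [Finset.sum_congr rfl fun j _ => hstep j, Finset.sum_add_distrib, ← Finset.sum_filter,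
      pow_succ]
    linarith

/-- With `T` of order `log m` rounds, every point is predicted correctly by a strict majority. -/
lemma exists_boost_majority {ι G : Type*} [Fintype ι] (wrong : G → ι → Prop)
    [∀ g, DecidablePred (wrong g)]
    (hweak : ∀ w : ι → ℝ, (∀ j, 0 ≤ w j) → ∃ g, 3 * ∑ j with wrong g j, w j ≤ ∑ j, w j) {T : ℕ}
    (hT : (Fintype.card ι : ℝ) ^ 2 < (9 / 8) ^ T) :
    ∃ g : Fin T → G, ∀ j, 2 * (Finset.univ.filter fun s => wrong (g s) j).card < T := by
  obtain ⟨g, hg⟩ := exists_boost wrong hweak T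
  refine ⟨g, fun j => ?_⟩
  by_contra! hcon
  set e := (Finset.univ.filter fun s => wrong (g s) j).card with he
  have h1 : (2 : ℝ) ^ e ≤ Fintype.card ι * (4 / 3) ^ T :=
    (Finset.single_le_sum (f := fun j =>
      (2 : ℝ) ^ (Finset.univ.filter fun s => wrong (g s) j).card)
      (fun i _ => by positivity) (Finset.mem_univ j)).trans hg
  have h2 : ((2 : ℝ) ^ e) ^ 2 ≤ (Fintype.card ι * (4 / 3) ^ T) ^ 2 :=
    pow_le_pow_left₀ (by positivity) h1 2
  have h3 : (2 : ℝ) ^ T ≤ ((2 : ℝ) ^ e) ^ 2 := by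
    rw [← pow_mul, mul_comm]
    exact pow_le_pow_right₀ (by norm_num) hcon
  have h4 : (2 : ℝ) ^ T = (9 / 8) ^ T * ((4 / 3) ^ T) ^ 2 := by
    rw [← pow_mul, mul_comm T 2, pow_mul, ← mul_pow]
    norm_num
  rw [h4] at h3
  rw [mul_pow] at h2
  have h5 : 0 < (((4 : ℝ) / 3) ^ T) ^ 2 := by positivity
  exact absurd (lt_of_mul_lt_mul_right ((h3.trans h2).trans_lt
    (mul_lt_mul_of_pos_right hT h5)) h5.le) (lt_irrefl _)

end Boosting

/-! ### The weak learner -/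

section Weak

variable {X : Type u} {N : ℕ} {α : Type*}

/-- The weak predictor read off from the rules `P`, the `N`-tuple of sample points with positions
`t` and the index `i`: the point to be labelled takes the `i`-th place of the tuple. -/
noncomputable def weakPredict (P : (Fin N → X) → Fin N → (Fin N → unitInterval) → unitInterval)
    (z : α → X × unitInterval) (t : Fin N → α) (i : Fin N) (x : X) : unitInterval :=
  P (Function.update (fun l => (z (t l)).1) i x) i fun l => (z (t l)).2

variable {H : Set (X → unitInterval)} {γ : ℝ} {k : ℕ}
  {P : (Fin N → X) → Fin N → (Fin N → unitInterval) → unitInterval}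

lemma weakPredict_labelled (hP : ∀ R, IsPredictionRule H R γ k (P R)) (h : X → unitInterval)
    (S : α → X) (t : Fin N → α) (i : Fin N) (x : X) :
    weakPredict P (fun j => (S j, h (S j))) t i x =
      P (Function.update (fun l => S (t l)) i x) i
        fun l => h (Function.update (fun l => S (t l)) i x l) :=
  (hP _).1 i _ _ fun j hj => by simp [hj]

/-- Exchangeability: if the tuple and the test point are drawn independently from the same weights,
then so are the entries of the tuple with the test point put in. Hence the average error of the
weak predictors is that of the rules, at most `k / N`. -/
lemma exists_weakPredict (hP : ∀ R, IsPredictionRule H R γ k (P R)) (hk : 3 * k ≤ N) (hN : 0 < N)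
    {h : X → unitInterval} (hh : h ∈ H) {m : ℕ} (S : Fin m → X) (hm : 0 < m) (w : Fin m → ℝ)
    (hw : ∀ j, 0 ≤ w j)
    [∀ t i, DecidablePred fun j =>
      γ < |(weakPredict P (labelled h S) t i (S j) : ℝ) - (h (S j) : ℝ)|] :
    ∃ (t : Fin N → Fin m) (i : Fin N),
      3 * ∑ j with γ < |(weakPredict P (labelled h S) t i (S j) : ℝ) - (h (S j) : ℝ)|, w j ≤
        ∑ j, w j := by
  classical
  set W := ∑ j, w j with hWdef
  have hW0 : 0 ≤ W := Finset.sum_nonneg fun j _ => hw j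
  by_contra! hcon
  -- `c i r` indicates that the rule for the tuple `r` errs in its `i`-th place.
  let c : Fin N → (Fin N → Fin m) → ℝ := fun i r =>
    if γ < |(P (fun l => S (r l)) i (fun l => h (S (r l))) : ℝ) - (h (S (r i)) : ℝ)| then 1 else 0
  let π : (Fin N → Fin m) → ℝ := fun r => ∏ l, w (r l)
  have hπ0 : ∀ r, 0 ≤ π r := fun r => Finset.prod_nonneg fun l _ => hw _
  have hπsum : ∑ r, π r = W ^ N := by
    rw [hWdef, Fintype.sum_pow]
  have hc : ∀ t i, ∑ j with γ < |(weakPredict P (labelled h S) t i (S j) : ℝ) - (h (S j) : ℝ)|, w j =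
      ∑ j, w j * c i (Function.update t i j) := by
    intro t i
    rw [Finset.sum_filter]
    refine Finset.sum_congr rfl fun j _ => ?_
    have h1 : (fun l => S (Function.update t i j l)) =
        Function.update (fun l => S (t l)) i (S j) := by
      ext l
      by_cases hl : l = i
      · subst hl; simp
      · simp [hl]
    have h2 : (fun l => h (S (Function.update t i j l))) =
        fun l => h (Function.update (fun l => S (t l)) i (S j) l) := by
      rw [← h1]
    have h3 := weakPredict_labelled hP h S t i (S j)
    have h4 : weakPredict P (labelled h S) t i (S j) =
        weakPredict P (fun j => (S j, h (S j))) t i (S j) := rfl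
    simp only [c, h4, h3, h2, h1, Function.update_self]
    split_ifs <;> simp
  have hswap : ∀ i, ∑ r, π r * ∑ j, w j * c i (Function.update r i j) = W * ∑ r, π r * c i r := by
    intro i
    let e : (Fin N → Fin m) × Fin m → (Fin N → Fin m) × Fin m := fun q =>
      (Function.update q.1 i q.2, q.1 i)
    have he : Function.Involutive e := by
      rintro ⟨r, j⟩
      simp [e]
    have h1 : ∑ r, π r * ∑ j, w j * c i (Function.update r i j) =
        ∑ q : (Fin N → Fin m) × Fin m, π (e q).1 * w (e q).2 * c i (e q).1 := by
      rw [Fintype.sum_prod_type]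
      refine Finset.sum_congr rfl fun r _ => ?_
      rw [Finset.mul_sum]
      refine Finset.sum_congr rfl fun j _ => ?_
      have h2 : π (Function.update r i j) * w (r i) = π r * w j := by
        simp only [π]
        rw [← Finset.mul_prod_erase _ _ (Finset.mem_univ i),
          ← Finset.mul_prod_erase Finset.univ (fun l => w (r l)) (Finset.mem_univ i)]
        have h3 : ∏ l ∈ Finset.univ.erase i, w (Function.update r i j l) =
            ∏ l ∈ Finset.univ.erase i, w (r l) :=
          Finset.prod_congr rfl fun l hl => by simp [Finset.ne_of_mem_erase hl]
        rw [h3]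
        simp only [Function.update_self]
        ring
      simp only [e]
      rw [h2]
      ring
    have h2 := Equiv.sum_comp he.toPerm
      (fun q : (Fin N → Fin m) × Fin m => π q.1 * w q.2 * c i q.1)
    simp only [Function.Involutive.coe_toPerm] at h2
    rw [h1, h2, Fintype.sum_prod_type, Finset.mul_sum]
    refine Finset.sum_congr rfl fun r _ => ?_
    rw [hWdef, Finset.sum_mul]
    exact Finset.sum_congr rfl fun j _ => by ring
  have hup : ∑ i, ∑ r, π r * c i r ≤ k * W ^ N := by
    rw [Finset.sum_comm, ← hπsum, Finset.mul_sum]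
    refine Finset.sum_le_sum fun r _ => ?_
    rw [← Finset.mul_sum, mul_comm]
    refine mul_le_mul_of_nonneg_right ?_ (hπ0 r)
    have h1 := (hP fun l => S (r l)).2 h hh
    simp only [c, Finset.sum_boole]
    exact_mod_cast by convert h1
  have hWpos : 0 < W := by
    refine hW0.lt_of_ne' fun hW => ?_
    have := hcon (fun _ => ⟨0, hm⟩) ⟨0, hN⟩
    have h2 : ∀ j, w j = 0 := fun j =>
      (Finset.sum_eq_zero_iff_of_nonneg fun j _ => hw j).1 hW j (Finset.mem_univ j)
    simp [h2, hW] at this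
  have hlow : W * (N * W ^ N) < 3 * (W * (k * W ^ N)) := by
    calc W * (N * W ^ N) = ∑ i : Fin N, ∑ r, π r * W := by
          simp_rw [← Finset.sum_mul, hπsum]
          simp
          ring
      _ < ∑ i : Fin N, ∑ r, π r * (3 * ∑ j, w j * c i (Function.update r i j)) := by
          have : Nonempty (Fin N) := ⟨⟨0, hN⟩⟩
          refine Finset.sum_lt_sum_of_nonempty Finset.univ_nonempty fun i _ => ?_
          obtain ⟨r, hr⟩ : ∃ r, 0 < π r := by
            by_contra! hall
            have : ∑ r, π r ≤ 0 := Finset.sum_nonpos fun r _ => hall r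
            rw [hπsum] at this
            exact absurd this (not_le.2 (by positivity))
          refine Finset.sum_lt_sum (fun r _ => ?_) ⟨r, Finset.mem_univ r, ?_⟩
          · refine mul_le_mul_of_nonneg_left ?_ (hπ0 r)
            rw [← hc]
            exact (hcon r i).le
          · refine mul_lt_mul_of_pos_left ?_ hr
            rw [← hc]
            exact hcon r i
      _ = 3 * (W * ∑ i, ∑ r, π r * c i r) := by
          rw [Finset.mul_sum, Finset.mul_sum]
          refine Finset.sum_congr rfl fun i _ => ?_
          rw [← hswap, Finset.mul_sum]
          exact Finset.sum_congr rfl fun r _ => by ring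
      _ ≤ 3 * (W * (k * W ^ N)) := by gcongr
  have hk' : (3 : ℝ) * k ≤ N := by exact_mod_cast hk
  have : 0 < W * W ^ N := by positivity
  nlinarith

end Weak

/-! ### Generalization from compression -/

section Generalization

/-- If a predictor is computed from a part `a` of the sample and `B` is the set of pairs `(a, x)`
for which it errs on `x`, then it is unlikely to be right on all remaining points `b` while having
error probability above `c`. -/
lemma measure_prod_consistent_le {A X β : Type*} [MeasurableSpace A] [MeasurableSpace X]
    [Fintype β] (μ : Measure A) [IsProbabilityMeasure μ] (D : Measure X) [IsProbabilityMeasure D]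
    {B : Set (A × X)} (hB : NullMeasurableSet B (μ.prod D)) (c : ℝ≥0∞) :
    (μ.prod (Measure.pi fun _ : β => D))
        {q | (∀ j, (q.1, q.2 j) ∉ B) ∧ c < D {x | (q.1, x) ∈ B}} ≤ (1 - c) ^ Fintype.card β := by
  obtain ⟨B', -, hB'm, hB'⟩ := hB.exists_measurable_superset_ae_eq
  have hmem : ∀ᵐ z ∂(μ.prod D), z ∈ B' ↔ z ∈ B := by
    filter_upwards [hB'] with z hz using Iff.of_eq hz
  -- Both the sections and the sample points only see `B` up to null sets.
  have h1 : ∀ᵐ q ∂(μ.prod (Measure.pi fun _ : β => D)),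
      D {x | (q.1, x) ∈ B'} = D {x | (q.1, x) ∈ B} := by
    refine Measure.quasiMeasurePreserving_fst.ae (p := fun a =>
      D {x | (a, x) ∈ B'} = D {x | (a, x) ∈ B}) ?_
    filter_upwards [Measure.ae_ae_of_ae_prod hmem] with a ha
    exact measure_congr (by filter_upwards [ha] with x hx using propext hx)
  have h2 : ∀ᵐ q ∂(μ.prod (Measure.pi fun _ : β => D)),
      ∀ j, ((q.1, q.2 j) ∈ B' ↔ (q.1, q.2 j) ∈ B) := by
    rw [ae_all_iff]
    intro j
    have hmp : MeasurePreserving (Prod.map id (Function.eval j))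
        (μ.prod (Measure.pi fun _ : β => D)) (μ.prod D) :=
      (MeasurePreserving.id μ).prod (measurePreserving_eval (fun _ : β => D) j)
    exact hmp.quasiMeasurePreserving.ae hmem
  set E' : Set (A × (β → X)) := {q | (∀ j, (q.1, q.2 j) ∉ B') ∧ c < D {x | (q.1, x) ∈ B'}} with hE'
  have hE'm : MeasurableSet E' := by
    have h3 : MeasurableSet {q : A × (β → X) | ∀ j, (q.1, q.2 j) ∉ B'} := by
      have : {q : A × (β → X) | ∀ j, (q.1, q.2 j) ∉ B'} =
          ⋂ j, (fun q : A × (β → X) => (q.1, q.2 j)) ⁻¹' B'ᶜ := by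
        ext q; simp
      rw [this]
      exact MeasurableSet.iInter fun j => hB'm.compl.preimage (by fun_prop)
    have h4 : MeasurableSet {q : A × (β → X) | c < D {x | (q.1, x) ∈ B'}} :=
      measurableSet_lt measurable_const
        ((measurable_measure_prodMk_left hB'm).comp measurable_fst)
    exact h3.inter h4
  calc _ ≤ (μ.prod (Measure.pi fun _ : β => D)) E' := by
        refine measure_mono_ae ?_
        filter_upwards [h1, h2] with q hq1 hq2 hq
        exact ⟨fun j hj => hq.1 j ((hq2 j).1 hj), by rw [hq1]; exact hq.2⟩
    _ = ∫⁻ a, (Measure.pi fun _ : β => D) (Prod.mk a ⁻¹' E') ∂μ := Measure.prod_apply hE'm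
    _ ≤ ∫⁻ _, (1 - c) ^ Fintype.card β ∂μ := by
        refine lintegral_mono fun a => ?_
        by_cases ha : c < D {x | (a, x) ∈ B'}
        · have hsub : Prod.mk a ⁻¹' E' ⊆ Set.univ.pi fun _ => {x | (a, x) ∈ B'}ᶜ :=
            fun b hb j _ => hb.1 j
          refine (measure_mono hsub).trans ?_
          rw [Measure.pi_pi]
          simp only [Finset.prod_const, Finset.card_univ]
          have hms : MeasurableSet {x | (a, x) ∈ B'} := hB'm.preimage measurable_prodMk_left
          rw [prob_compl_eq_one_sub hms]
          gcongr
        · have : Prod.mk a ⁻¹' E' = ∅ := by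
            ext b
            simp [hE', ha]
          simp [this]
    _ = (1 - c) ^ Fintype.card β := by simp

lemma measure_pi_consistent_le {X ι : Type*} [MeasurableSpace X] [Fintype ι] (p : ι → Prop)
    [DecidablePred p] (D : Measure X) [IsProbabilityMeasure D] {B : Set (({j // p j} → X) × X)}
    (hB : NullMeasurableSet B ((Measure.pi fun _ => D).prod D)) (c : ℝ≥0∞) :
    (Measure.pi fun _ : ι => D) {S | (∀ j, ¬ p j → ((fun a : {j // p j} => S a), S j) ∉ B) ∧
      c < D {x | ((fun a : {j // p j} => S a), x) ∈ B}} ≤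
      (1 - c) ^ Fintype.card {j // ¬ p j} := by
  refine le_trans (le_of_eq ?_) (measure_prod_consistent_le (β := {j // ¬ p j}) _ D hB c)
  rw [← (measurePreserving_piEquivPiSubtypeProd (fun _ : ι => D) p).measure_preimage_equiv]
  congr 1
  ext S
  simp [MeasurableEquiv.piEquivPiSubtypeProd, Equiv.piEquivPiSubtypeProd]

end Generalization

/-! ### The boosted learner -/

section Learner

lemma aemeasurable_abs_sub {Y : Type*} [MeasurableSpace Y] {μ : Measure Y} {f g : Y → unitInterval}
    (hf : AEMeasurable f μ) (hg : AEMeasurable g μ) :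
    AEMeasurable (fun y => |(f y : ℝ) - (g y : ℝ)|) μ :=
  continuous_abs.measurable.comp_aemeasurable
    ((measurable_subtype_coe.comp_aemeasurable hf).sub (measurable_subtype_coe.comp_aemeasurable hg))

variable {X : Type u} {N T : ℕ} {α : Type*}

/-- The median of the weak predictors given by the positions `t s` and the indices `i s`. -/
noncomputable def vote (P : (Fin N → X) → Fin N → (Fin N → unitInterval) → unitInterval)
    (z : α → X × unitInterval) (q : Fin T → (Fin N → α) × Fin N) (x : X) : unitInterval :=
  median fun s => weakPredict P z (q s).1 (q s).2 x

open Classical in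
/-- The learner that looks for a vote of `T m` weak predictors that is within `γ` of all labels of
the sample. It predicts `0` if there is none, which does not happen on samples labelled by the
class. -/
noncomputable def boostLearner (P : (Fin N → X) → Fin N → (Fin N → unitInterval) → unitInterval)
    (γ : ℝ) (T : ℕ → ℕ) : Learner X := fun m z =>
  if hq : ∃ q : Fin (T m) → (Fin N → Fin m) × Fin N, ∀ j,
    |(vote P z q (z j).1 : ℝ) - ((z j).2 : ℝ)| ≤ γ then vote P z hq.choose else fun _ => 0

variable {H : Set (X → unitInterval)} {γ : ℝ} {k : ℕ}
  {P : (Fin N → X) → Fin N → (Fin N → unitInterval) → unitInterval}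

lemma exists_boostLearner_eq (hP : ∀ R, IsPredictionRule H R γ k (P R)) (hk : 3 * k ≤ N)
    (hN : 0 < N) {h : X → unitInterval} (hh : h ∈ H) {m : ℕ} (hm : 0 < m) {T : ℕ → ℕ}
    (hT : (m : ℝ) ^ 2 < (9 / 8) ^ T m) (S : Fin m → X) :
    ∃ q : Fin (T m) → (Fin N → Fin m) × Fin N,
      boostLearner P γ T m (labelled h S) = vote P (labelled h S) q ∧
      ∀ j, |(vote P (labelled h S) q (S j) : ℝ) - (h (S j) : ℝ)| ≤ γ := by
  classical
  have hex : ∃ q : Fin (T m) → (Fin N → Fin m) × Fin N, ∀ j,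
      |(vote P (labelled h S) q (labelled h S j).1 : ℝ) - ((labelled h S j).2 : ℝ)| ≤ γ := by
    obtain ⟨q, hq⟩ := exists_boost_majority
      (wrong := fun (g : (Fin N → Fin m) × Fin N) (j : Fin m) =>
        γ < |(weakPredict P (labelled h S) g.1 g.2 (S j) : ℝ) - (h (S j) : ℝ)|)
      (fun w hw => by
        obtain ⟨t, i, hti⟩ := exists_weakPredict hP hk hN hh S hm w hw
        exact ⟨(t, i), hti⟩) (T := T m) (by simpa using hT)
    refine ⟨q, fun j => abs_median_sub_le _ _ _ ?_⟩
    exact hq j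
  refine ⟨hex.choose, ?_, hex.choose_spec⟩
  rw [boostLearner, dif_pos hex]

variable [MeasurableSpace X]

lemma aemeasurable_vote (hP : ∀ R, IsPredictionRule H R γ k (P R)) {h : X → unitInterval}
    (hPm : ∀ i, UnivMeasurable fun R : Fin N → X => P R i fun j => h (R j))
    (μ : Measure (α → X)) [IsProbabilityMeasure μ] (D : Measure X) [IsProbabilityMeasure D]
    (q : Fin T → (Fin N → α) × Fin N) :
    AEMeasurable (fun y : (α → X) × X => vote P (fun j => (y.1 j, h (y.1 j))) q y.2)
      (μ.prod D) := by
  refine (continuous_median T).measurable.comp_aemeasurable (aemeasurable_pi_lambda _ fun s => ?_)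
  have hmeas : Measurable fun y : (α → X) × X =>
      (Function.update (fun l => y.1 ((q s).1 l)) (q s).2 y.2 : Fin N → X) := by
    refine measurable_pi_lambda _ fun l => ?_
    by_cases hl : l = (q s).2
    · subst hl
      simpa using measurable_snd
    · simp only [Function.update_of_ne hl]
      fun_prop
  have := Measure.isProbabilityMeasure_map (μ := μ.prod D) hmeas.aemeasurable
  have h1 := (hPm (q s).2 ((μ.prod D).map _)).comp_measurable hmeas
  refine h1.congr (Filter.Eventually.of_forall fun y => ?_)
  exact (weakPredict_labelled hP h y.1 (q s).1 (q s).2 y.2).symm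

/-- For a fixed choice of positions in the sample, a vote that is consistent with the sample has
small error: the points at the remaining positions are independent of it. -/
lemma measure_vote_consistent_le (hP : ∀ R, IsPredictionRule H R γ k (P R)) {h : X → unitInterval}
    (hPm : ∀ i, UnivMeasurable fun R : Fin N → X => P R i fun j => h (R j))
    (hh : UnivMeasurable h) (D : Measure X) [IsProbabilityMeasure D] {m : ℕ}
    (q : Fin T → (Fin N → Fin m) × Fin N) (c : ℝ≥0∞) :
    iid D m {S | (∀ j, |(vote P (labelled h S) q (S j) : ℝ) - (h (S j) : ℝ)| ≤ γ) ∧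
      c < D {x | γ < |(vote P (labelled h S) q x : ℝ) - (h x : ℝ)|}} ≤
      (1 - c) ^ (m - T * N) := by
  classical
  let p : Fin m → Prop := fun j => ∃ y : Fin T × Fin N, (q y.1).1 y.2 = j
  let q' : Fin T → (Fin N → {j // p j}) × Fin N := fun s =>
    (fun l => ⟨(q s).1 l, (s, l), rfl⟩, (q s).2)
  have hvote : ∀ (S : Fin m → X) x, vote P (labelled h S) q x =
      vote P (fun j : {j // p j} => (S j, h (S j))) q' x := fun S x => rfl
  let B : Set (({j // p j} → X) × X) :=
    {y | γ < |(vote P (fun j => (y.1 j, h (y.1 j))) q' y.2 : ℝ) - (h y.2 : ℝ)|}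
  have hB : NullMeasurableSet B ((Measure.pi fun _ => D).prod D) := by
    refine nullMeasurableSet_lt aemeasurable_const ?_
    have h1 := aemeasurable_vote hP hPm (Measure.pi fun _ : {j // p j} => D) D q'
    have h2 : AEMeasurable (fun y : ({j // p j} → X) × X => h y.2)
        ((Measure.pi fun _ => D).prod D) :=
      (hh D).comp_quasiMeasurePreserving Measure.quasiMeasurePreserving_snd
    exact aemeasurable_abs_sub h1 h2
  have hcard : m - T * N ≤ Fintype.card {j // ¬ p j} := by
    have h1 : Fintype.card {j // p j} ≤ T * N := by
      have := Fintype.card_le_of_surjective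
        (fun y : Fin T × Fin N => (⟨(q y.1).1 y.2, y, rfl⟩ : {j // p j}))
        (by rintro ⟨j, y, rfl⟩; exact ⟨y, rfl⟩)
      simpa using this
    have h2 := Fintype.card_subtype_compl p
    have h3 := Fintype.card_fin m
    omega
  refine (measure_mono ?_).trans ((measure_pi_consistent_le p D hB c).trans
    (pow_le_pow_right_of_le_one' tsub_le_self hcard))
  rintro S ⟨h1, h2⟩
  refine ⟨fun j _ hj => (h1 j).not_gt ?_, ?_⟩
  · rw [hvote]; exact hj
  · simp only [hvote] at h2
    exact h2

/-- Almost every sample leads the boosted learner to a predictor whose loss is measurable. -/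
lemma ae_aemeasurable_boostLearner (hP : ∀ R, IsPredictionRule H R γ k (P R)) (hk : 3 * k ≤ N)
    (hN : 0 < N) {h : X → unitInterval} (hh : h ∈ H)
    (hPm : ∀ i, UnivMeasurable fun R : Fin N → X => P R i fun j => h (R j))
    (hhm : UnivMeasurable h) (D : Measure X) [IsProbabilityMeasure D] {m : ℕ} (hm : 0 < m)
    {T : ℕ → ℕ} (hT : (m : ℝ) ^ 2 < (9 / 8) ^ T m) :
    ∀ᵐ S ∂iid D m, AEMeasurable (fun x =>
      |(boostLearner P γ T m (labelled h S) x : ℝ) - (h x : ℝ)|) D := by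
  have hvote : ∀ᵐ S ∂iid D m, ∀ q : Fin (T m) → (Fin N → Fin m) × Fin N,
      AEMeasurable (fun x => vote P (labelled h S) q x) D := by
    rw [ae_all_iff]
    intro q
    have h1 := aemeasurable_vote hP hPm (Measure.pi fun _ : Fin m => D) D q
    exact h1.aestronglyMeasurable.prodMk_left.mono fun S hS => hS.aemeasurable
  filter_upwards [hvote] with S hS
  obtain ⟨q, hq, -⟩ := exists_boostLearner_eq hP hk hN hh hm hT S
  rw [hq]
  exact aemeasurable_abs_sub (hS q) (hhm D)

/-- A union bound over all possible votes controls the boosted learner. -/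
lemma measure_boostLearner_fail_le (hP : ∀ R, IsPredictionRule H R γ k (P R)) (hk : 3 * k ≤ N)
    (hN : 0 < N) {h : X → unitInterval} (hh : h ∈ H)
    (hPm : ∀ i, UnivMeasurable fun R : Fin N → X => P R i fun j => h (R j))
    (hhm : UnivMeasurable h) (D : Measure X) [IsProbabilityMeasure D] {m : ℕ} (hm : 0 < m)
    {T : ℕ → ℕ} (hT : (m : ℝ) ^ 2 < (9 / 8) ^ T m) (c : ℝ≥0∞) :
    iid D m {S | c < D {x | γ < |(boostLearner P γ T m (labelled h S) x : ℝ) - (h x : ℝ)|}} ≤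
      ((m : ℝ≥0∞) ^ N * N) ^ T m * (1 - c) ^ (m - T m * N) := by
  calc _ ≤ iid D m (⋃ q : Fin (T m) → (Fin N → Fin m) × Fin N,
          {S | (∀ j, |(vote P (labelled h S) q (S j) : ℝ) - (h (S j) : ℝ)| ≤ γ) ∧
            c < D {x | γ < |(vote P (labelled h S) q x : ℝ) - (h x : ℝ)|}}) := by
        refine measure_mono fun S hS => ?_
        obtain ⟨q, hq, hcons⟩ := exists_boostLearner_eq hP hk hN hh hm hT S
        refine Set.mem_iUnion.2 ⟨q, hcons, ?_⟩
        rw [← hq]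
        exact hS
    _ ≤ ∑ q, _ := by
        refine (measure_iUnion_le _).trans ?_
        rw [tsum_fintype]
    _ ≤ ∑ _q : Fin (T m) → (Fin N → Fin m) × Fin N, (1 - c) ^ (m - T m * N) :=
        Finset.sum_le_sum fun q _ => measure_vote_consistent_le hP hPm hhm D q c
    _ = _ := by simp

end Learner

/-! ### The dimension as a function of the scale -/

section Dim

variable {X : Type u} {H : Set (X → unitInterval)} {γ : ℝ}

lemma exists_witness_of_lt_dim {k : ℕ} (hk : (k : ℕ∞) < dim H γ) :
    ∃ n : ℕ, k < n ∧ ∃ S : Fin n → X, ∃ V : Set (Fin n → unitInterval), V.Finite ∧ V ⊆ proj H S ∧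
      ∀ σ, IsOrientation V σ → ∃ v ∈ V, (n : ℝ) / 3 < (outdeg V σ γ v : ℝ) := by
  obtain ⟨n, hn⟩ := lt_iSup_iff.1 hk
  obtain ⟨hn, hkn⟩ := lt_iSup_iff.1 hn
  exact ⟨n, by exact_mod_cast hkn, hn⟩

lemma outdeg_antitone {n : ℕ} {V : Set (Fin n → unitInterval)}
    {σ : Set (Fin n → unitInterval) → (Fin n → unitInterval)} {v : Fin n → unitInterval} :
    Antitone fun γ => outdeg V σ γ v := by
  classical
  intro γ γ' h
  exact Finset.card_le_card fun i hi =>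
    Finset.mem_filter.2 ⟨Finset.mem_univ i, h.trans_lt (Finset.mem_filter.1 hi).2⟩

lemma dim_antitone (H : Set (X → unitInterval)) : Antitone (dim H) := by
  intro γ γ' h
  refine iSup₂_le fun n hn => ?_
  obtain ⟨S, V, hVf, hV, hσ⟩ := hn
  refine le_iSup₂_of_le n ⟨S, V, hVf, hV, fun σ ho => ?_⟩ le_rfl
  obtain ⟨v, hv, hlt⟩ := hσ σ ho
  exact ⟨v, hv, hlt.trans_le (by exact_mod_cast outdeg_antitone h)⟩

lemma dim_one (H : Set (X → unitInterval)) : dim H 1 = 0 := by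
  classical
  refine le_antisymm (iSup₂_le fun n hn => ?_) zero_le
  obtain ⟨S, V, hVf, hV, hσ⟩ := hn
  obtain ⟨σ, ho⟩ := exists_isOrientation V
  obtain ⟨v, hv, hlt⟩ := hσ σ ho
  have h0 : outdeg V σ 1 v = 0 := by
    refine Finset.card_eq_zero.2 (Finset.filter_eq_empty_iff.2 fun i _ => not_lt.2 ?_)
    have h1 := (σ (edge V i v) i).2
    have h2 := (v i).2
    rw [abs_le]
    constructor <;> linarith [h1.1, h1.2, h2.1, h2.2]
  rw [h0] at hlt
  have : (0 : ℝ) ≤ n := Nat.cast_nonneg n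
  simp only [Nat.cast_zero] at hlt
  linarith

/-- The dimension is right-continuous: a finite set of vertices has only finitely many
displacements, so a slightly larger scale gives the same out-degrees. -/
lemma dim_le_of_forall_gt {d : ℕ∞} (h : ∀ γ' > γ, dim H γ' ≤ d) : dim H γ ≤ d := by
  classical
  refine iSup₂_le fun n hn => ?_
  obtain ⟨S, V, hVf, hV, hσ⟩ := hn
  set E : Set ℝ := {r | γ < r} ∩
    (fun q : ((Fin n → unitInterval) × (Fin n → unitInterval)) × Fin n =>
      |(q.1.1 q.2 : ℝ) - (q.1.2 q.2 : ℝ)|) '' ((V ×ˢ V) ×ˢ Set.univ) with hE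
  have hEf : E.Finite := (((hVf.prod hVf).prod Set.finite_univ).image _).inter_of_right _
  obtain ⟨γ', hγ', hlt⟩ : ∃ γ' > γ, ∀ r ∈ E, γ' < r := by
    rcases E.eq_empty_or_nonempty with h0 | h0
    · exact ⟨γ + 1, by simp, by simp [h0]⟩
    · obtain ⟨r, hr, hmin⟩ := Set.exists_min_image E id hEf h0
      have hr' : γ < r := hr.1
      exact ⟨(γ + r) / 2, by simp only [gt_iff_lt]; linarith, fun s hs => by
        have := hmin s hs
        simp only [id] at this
        linarith⟩
  refine le_trans (le_iSup₂_of_le n ⟨S, V, hVf, hV, fun σ ho => ?_⟩ le_rfl) (h γ' hγ')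
  obtain ⟨v, hv, hlt'⟩ := hσ σ ho
  refine ⟨v, hv, hlt'.trans_le ?_⟩
  refine Nat.cast_le.2 (Finset.card_le_card fun i hi => ?_)
  refine Finset.mem_filter.2 ⟨Finset.mem_univ i, hlt _ ⟨(Finset.mem_filter.1 hi).2, ?_⟩⟩
  exact ⟨((σ (edge V i v), v), i), ⟨⟨(ho _ (edge_mem_edges hv)).1, hv⟩, trivial⟩, rfl⟩

lemma abs_sub_le_of_dim_eq_zero (hd : dim H γ = 0) {g h : X → unitInterval} (hg : g ∈ H)
    (hh : h ∈ H) (x : X) : |(g x : ℝ) - (h x : ℝ)| ≤ γ := by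
  classical
  set a : Fin 1 → unitInterval := fun _ => g x
  set b : Fin 1 → unitInterval := fun _ => h x
  obtain ⟨σ, ho, hout⟩ := exists_orientation_of_dim_lt (H := H) (γ := γ) (n := 1) (by simp [hd])
    (fun _ => x) (V := {a, b}) (Set.toFinite _)
    (by rintro v (rfl | rfl) <;> [exact ⟨g, hg, rfl⟩; exact ⟨h, hh, rfl⟩])
  have hedge : ∀ v, edge {a, b} (0 : Fin 1) v = {a, b} := fun v =>
    Set.Subset.antisymm (fun w hw => hw.1) fun w hw => ⟨hw, fun j hj => absurd (Subsingleton.elim _ _) hj⟩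
  have hle : ∀ v ∈ ({a, b} : Set (Fin 1 → unitInterval)),
      |((σ {a, b} 0 : unitInterval) : ℝ) - (v 0 : ℝ)| ≤ γ := by
    intro v hv
    have h0 : outdeg {a, b} σ γ v = 0 := Nat.le_zero.1 (hout v hv)
    have := Finset.filter_eq_empty_iff.1 (Finset.card_eq_zero.1 h0) (Finset.mem_univ 0)
    rw [hedge] at this
    exact not_lt.1 this
  have hmem : σ {a, b} ∈ ({a, b} : Set (Fin 1 → unitInterval)) := by
    have := ho _ (edge_mem_edges (i := 0) (Set.mem_insert a {b}))
    rwa [hedge] at this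
  rcases hmem with he | he
  · have := hle b (by simp)
    rwa [he] at this
  · have := hle a (by simp)
    rw [he, abs_sub_comm] at this
    exact this

end Dim

/-! ### Numerical estimates -/

section Numeric

/-- The number of weak predictors in a vote on `m` sample points. The factor `18` makes
`(9 / 8) ^ rounds m` exceed `m ^ 2`, as `log (9 / 8) ≥ 1 / 9`. -/
noncomputable def rounds (m : ℕ) : ℕ := ⌈18 * Real.log (m + 1)⌉₊

lemma half_le_log_succ {m : ℕ} (hm : 1 ≤ m) : 1 / 2 ≤ Real.log (m + 1) := by
  have h1 : Real.log 2 ≤ Real.log (m + 1) :=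
    Real.log_le_log (by norm_num) (by have : (1 : ℝ) ≤ m := by exact_mod_cast hm
                                      linarith)
  linarith [Real.log_two_gt_d9]

lemma sq_lt_pow_rounds {m : ℕ} (hm : 1 ≤ m) : (m : ℝ) ^ 2 < (9 / 8) ^ rounds m := by
  have hm' : (0 : ℝ) < m := by exact_mod_cast hm
  rw [← Real.log_lt_log_iff (by positivity) (by positivity), Real.log_pow, Real.log_pow]
  have h1 : (1 : ℝ) / 9 ≤ Real.log (9 / 8) := by
    have := Real.one_sub_inv_le_log_of_pos (x := 9 / 8) (by norm_num)
    norm_num at this ⊢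
    exact this
  have h2 : 18 * Real.log (m + 1) ≤ rounds m := Nat.le_ceil _
  have h3 : Real.log m < Real.log (m + 1) := Real.log_lt_log hm' (by linarith)
  have h4 := half_le_log_succ hm
  have h5 : (rounds m : ℝ) * (1 / 9) ≤ rounds m * Real.log (9 / 8) :=
    mul_le_mul_of_nonneg_left h1 (Nat.cast_nonneg _)
  push_cast
  linarith

lemma rounds_le {m : ℕ} (hm : 1 ≤ m) : (rounds m : ℝ) ≤ 20 * Real.log (m + 1) := by
  have h1 := half_le_log_succ hm
  have h2 := (Nat.ceil_lt_add_one (a := 18 * Real.log (m + 1)) (by linarith)).le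
  rw [rounds]
  linarith

/-- The union bound over all votes, at the error level of the upper bounds. -/
lemma union_bound_le {m d : ℕ} {δ e : ℝ} (hd : 1 ≤ d) (hm : 1 ≤ m) (hδ : 0 < δ) (hδ' : δ < 1)
    (he : e = 240 * (d * Real.log (m + 1) ^ 2 + Real.log (1 / δ)) / m) (he1 : e < 1) :
    ((m : ℝ) ^ (d + 1) * (d + 1 : ℕ)) ^ rounds m * (1 - e) ^ (m - rounds m * (d + 1)) ≤ δ := by
  have hm' : (0 : ℝ) < m := by exact_mod_cast hm
  have hd' : (1 : ℝ) ≤ d := by exact_mod_cast hd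
  set L := Real.log (m + 1) with hL
  have hL1 : 1 / 2 ≤ L := half_le_log_succ hm
  have hlogm : Real.log m ≤ L := Real.log_le_log hm' (by linarith)
  have hlogδ : 0 < Real.log (1 / δ) := Real.log_pos (by rw [lt_div_iff₀ hδ]; linarith)
  have hT : (rounds m : ℝ) ≤ 20 * L := rounds_le hm
  set T := rounds m
  have hT0 : (0 : ℝ) ≤ T := Nat.cast_nonneg _
  have hem : e * m = 240 * (d * L ^ 2 + Real.log (1 / δ)) := by
    rw [he]; field_simp
  have he0 : 0 ≤ e := by rw [he]; positivity
  have hdL : d * L ≤ 2 * (d * L ^ 2) := by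
    have : d * L ≤ d * (2 * L ^ 2) := mul_le_mul_of_nonneg_left (by nlinarith) (by linarith)
    linarith
  have hTN : (T : ℝ) * (d + 1) ≤ 40 * (d * L) := by
    calc (T : ℝ) * (d + 1) ≤ (20 * L) * (2 * d) :=
          mul_le_mul hT (by linarith) (by linarith) (by linarith)
      _ = 40 * (d * L) := by ring
  have hm240 : 240 * (d * L ^ 2 + Real.log (1 / δ)) < m := by
    rw [← hem]; nlinarith
  have hhalf : (T : ℝ) * (d + 1) ≤ m / 2 := by linarith
  have hsub : (m : ℝ) / 2 ≤ ((m - T * (d + 1) : ℕ) : ℝ) := by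
    rw [Nat.cast_sub]
    · push_cast; linarith
    · have : (T : ℝ) * (d + 1) ≤ m := by linarith
      exact_mod_cast this
  have h1 : (1 - e) ^ (m - T * (d + 1)) ≤ Real.exp (-(e * m / 2)) := by
    calc (1 - e) ^ (m - T * (d + 1)) ≤ Real.exp (-e) ^ (m - T * (d + 1)) :=
          pow_le_pow_left₀ (by linarith) (by linarith [Real.add_one_le_exp (-e)]) _
      _ = Real.exp (-(e * (m - T * (d + 1) : ℕ))) := by
          rw [← Real.exp_nat_mul]; congr 1; ring
      _ ≤ _ := by
          refine Real.exp_le_exp.2 ?_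
          nlinarith
  have h2 : ((m : ℝ) ^ (d + 1) * (d + 1 : ℕ)) ^ T ≤ Real.exp (120 * (d * L ^ 2)) := by
    have hpos : (0 : ℝ) < (m : ℝ) ^ (d + 1) * (d + 1 : ℕ) := by positivity
    rw [← Real.exp_log (pow_pos hpos T), Real.log_pow, Real.log_mul (by positivity)
      (by positivity), Real.log_pow]
    refine Real.exp_le_exp.2 ?_
    have h3 : Real.log ((d + 1 : ℕ) : ℝ) ≤ (d + 1 : ℕ) := by
      have := Real.log_le_sub_one_of_pos (x := ((d + 1 : ℕ) : ℝ)) (by positivity)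
      linarith
    push_cast at h3 ⊢
    have h4 : ((d : ℝ) + 1) * Real.log m + Real.log (d + 1) ≤ 3 * ((d + 1) * L) := by nlinarith
    calc (T : ℝ) * (((d : ℝ) + 1) * Real.log m + Real.log (d + 1))
        ≤ T * (3 * ((d + 1) * L)) := mul_le_mul_of_nonneg_left h4 hT0
      _ = 3 * L * (T * (d + 1)) := by ring
      _ ≤ 3 * L * (40 * (d * L)) := mul_le_mul_of_nonneg_left hTN (by linarith)
      _ = 120 * (d * L ^ 2) := by ring
  calc _ ≤ Real.exp (120 * (d * L ^ 2)) * Real.exp (-(e * m / 2)) :=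
        mul_le_mul h2 h1 (pow_nonneg (by linarith) _) (Real.exp_pos _).le
    _ ≤ Real.exp (- Real.log (1 / δ)) := by
        rw [← Real.exp_add, hem]
        refine Real.exp_le_exp.2 ?_
        nlinarith
    _ = δ := by
        rw [one_div, Real.log_inv, neg_neg, Real.exp_log hδ]

/-- Inversion of the error level: `m` of order `u * log u ^ 2` exceeds `u * log m ^ 2`. Writing
`m = u * r`, the logarithm splits into `log u`, controlled by `r`, and `log r`, which is of smaller
order than `r`. -/
lemma mul_log_sq_le {u m : ℝ} (hu : 2 ≤ u) (hm : 10 ^ 10 * (u * Real.log u ^ 2) ≤ m) :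
    960 * (u * Real.log m ^ 2) ≤ m := by
  have hu0 : 0 < u := by linarith
  have hlogu : 0.69 ≤ Real.log u :=
    le_trans (by linarith [Real.log_two_gt_d9]) (Real.log_le_log (by norm_num) hu)
  obtain ⟨r, rfl⟩ : ∃ r, m = u * r := ⟨m / u, by field_simp⟩
  have hr : 10 ^ 10 * Real.log u ^ 2 ≤ r := by
    refine le_of_mul_le_mul_left ?_ hu0
    linarith
  -- `61440 = 64 * 960` is what `16 * √r ≤ r / (4 * 960)` requires of `√r`.
  have hr1 : (61440 : ℝ) ^ 2 ≤ r := by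
    refine le_trans ?_ hr
    nlinarith
  have hr0 : 0 < r := lt_of_lt_of_le (by norm_num) hr1
  have hs : 61440 ≤ √r := Real.le_sqrt_of_sq_le hr1
  have hlogr0 : 0 ≤ Real.log r := Real.log_nonneg (le_trans (by norm_num) hr1)
  have hlogr : Real.log r ≤ 4 * √(√r) := by
    have h1 : Real.log r = 4 * Real.log (√(√r)) := by
      rw [Real.log_sqrt (Real.sqrt_nonneg _), Real.log_sqrt hr0.le]
      ring
    have h2 := Real.log_le_sub_one_of_pos (x := √(√r)) (by positivity)
    linarith
  have hlogr2 : Real.log r ^ 2 ≤ 16 * √r := by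
    calc Real.log r ^ 2 ≤ (4 * √(√r)) ^ 2 := pow_le_pow_left₀ hlogr0 hlogr 2
      _ = 16 * √r := by
        rw [mul_pow, Real.sq_sqrt (Real.sqrt_nonneg _)]
        norm_num
  have hsr : 61440 * √r ≤ r := by
    nlinarith [Real.mul_self_sqrt hr0.le]
  rw [Real.log_mul hu0.ne' hr0.ne']
  have h3 : 960 * (Real.log u + Real.log r) ^ 2 ≤ r := by
    nlinarith [sq_nonneg (Real.log u - Real.log r)]
  nlinarith

/-- The sample size of the upper bound brings the error level of the boosted learner below `ε`. -/
lemma error_level_le {m d : ℕ} {δ ε : ℝ} (hd : 1 ≤ d) (hε : 0 < ε) (hε' : ε < 1)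
    (hδ : 0 < δ) (hδ' : δ < 1)
    (hm : 2 * 10 ^ 10 * (d / ε * Real.log (2 * d / ε) ^ 2 + 1 / ε * Real.log (1 / δ)) ≤ m) :
    240 * (d * Real.log (m + 1) ^ 2 + Real.log (1 / δ)) / m ≤ ε := by
  have hd' : (1 : ℝ) ≤ d := by exact_mod_cast hd
  have hlogδ : 0 < Real.log (1 / δ) := Real.log_pos (by rw [lt_div_iff₀ hδ]; linarith)
  set u : ℝ := 2 * d / ε with hu
  have hu2 : 2 ≤ u := by
    rw [hu, le_div_iff₀ hε]; nlinarith
  have hdu : d / ε = u / 2 := by rw [hu]; ring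
  have huε : u * ε = 2 * d := by rw [hu]; field_simp
  rw [hdu] at hm
  have hlogu : 0.69 ≤ Real.log u :=
    le_trans (by linarith [Real.log_two_gt_d9]) (Real.log_le_log (by norm_num) hu2)
  have h1 : 0 ≤ 1 / ε * Real.log (1 / δ) := by positivity
  have h2 : 0 ≤ u * Real.log u ^ 2 := by positivity
  have hm1 : 10 ^ 10 * (u * Real.log u ^ 2) ≤ m := by linarith
  have hm2 : (2 : ℝ) ≤ m := by
    refine le_trans ?_ hm1
    have : 0.25 ≤ Real.log u ^ 2 := by nlinarith
    nlinarith
  have hm0 : (0 : ℝ) < m := by linarith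
  have h3 := mul_log_sq_le hu2 hm1
  have h4 : Real.log (m + 1) ≤ 2 * Real.log m := by
    rw [← Nat.cast_ofNat (R := ℝ) (n := 2), ← Real.log_pow]
    exact Real.log_le_log (by linarith) (by nlinarith)
  have h5 : Real.log (m + 1) ^ 2 ≤ 4 * Real.log m ^ 2 := by
    have h0 : 0 ≤ Real.log (m + 1) := Real.log_nonneg (by linarith)
    nlinarith
  have h6 : 240 * (u * Real.log (m + 1) ^ 2) ≤ m := by nlinarith
  have h7 : 240 * Real.log (1 / δ) ≤ ε * m / 2 := by
    have h8 : 480 * (1 / ε * Real.log (1 / δ)) ≤ m := by linarith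
    have h9 := mul_le_mul_of_nonneg_left h8 hε.le
    have h10 : ε * (480 * (1 / ε * Real.log (1 / δ))) = 480 * Real.log (1 / δ) := by
      field_simp
    linarith
  have h11 : 240 * (d * Real.log (m + 1) ^ 2) ≤ ε * m / 2 := by
    have h12 := mul_le_mul_of_nonneg_left h6 hε.le
    have h13 : ε * (240 * (u * Real.log (m + 1) ^ 2)) =
        240 * ((u * ε) * Real.log (m + 1) ^ 2) := by ring
    rw [h13, huε] at h12
    linarith
  rw [div_le_iff₀ hm0]
  linarith

end Numeric

/-! ### The learner at a fixed scale -/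

section UpperBound

variable {X : Type u} [MeasurableSpace X] {H : Set (X → unitInterval)}

lemma log_one_div_nonneg {δ : ℝ} (hδ : 0 < δ) (hδ' : δ < 1) : 0 ≤ Real.log (1 / δ) :=
  Real.log_nonneg (by rw [le_div_iff₀ hδ]; linarith)

/-- At a scale `γ` of dimension at most `d`, the boosted learner has cut-off error of order
`(d * log² m + log (1 / δ)) / m` with probability `1 - δ`, for all `m` and `δ` at once. -/
lemma exists_learner (hH : Admissible H) {γ : ℝ} (hγ : 0 ≤ γ) {d : ℕ} (hd : dim H γ ≤ d) :
    ∃ A : Learner X, ∀ m, 1 ≤ m → ∀ δ : ℝ, 0 < δ → δ < 1 → ∀ h ∈ H,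
      ∀ (D : Measure X) [IsProbabilityMeasure D],
        iid D m {S | ¬ (AEMeasurable (fun x => |(A m (labelled h S) x : ℝ) - (h x : ℝ)|) D ∧
          CutoffLossLE D γ (A m (labelled h S)) h
            (ENNReal.ofReal (240 * (d * Real.log (m + 1) ^ 2 + Real.log (1 / δ)) / m)))} ≤
          ENNReal.ofReal δ := by
  rcases Nat.eq_zero_or_pos d with rfl | hd1
  · rcases H.eq_empty_or_nonempty with rfl | ⟨h₀, hh₀⟩
    · exact ⟨fun _ _ _ => 0, by simp⟩
    have hd0 : dim H γ = 0 := by simpa using hd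
    refine ⟨fun _ _ => h₀, fun m _ δ _ _ h hh D _ => ?_⟩
    have h1 : AEMeasurable (fun x => |(h₀ x : ℝ) - (h x : ℝ)|) D :=
      aemeasurable_abs_sub (hH.1 h₀ hh₀ D) (hH.1 h hh D)
    have h2 : {x | γ < |(h₀ x : ℝ) - (h x : ℝ)|} = ∅ := by
      ext x
      simpa using abs_sub_le_of_dim_eq_zero hd0 hh₀ hh x
    simp [CutoffLossLE, h1, h2]
  · have hlt : dim H γ < ((d + 1 : ℕ) : ℕ∞) := hd.trans_lt (by exact_mod_cast Nat.lt_succ_self d)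
    obtain ⟨P, hP, hPm⟩ := hH.2 (d + 1) ((d + 1) / 3) γ hγ fun S => exists_isPredictionRule hlt S
    refine ⟨boostLearner P γ rounds, fun m hm δ hδ hδ' h hh D _ => ?_⟩
    set e := 240 * (d * Real.log (m + 1) ^ 2 + Real.log (1 / δ)) / m with he
    have he0 : 0 ≤ e := by
      have := log_one_div_nonneg hδ hδ'
      positivity
    have hk := Nat.mul_div_le (d + 1) 3
    have hmeas := ae_aemeasurable_boostLearner hP hk d.succ_pos hh (hPm h hh) (hH.1 h hh) D hm
      (sq_lt_pow_rounds hm)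
    have hfail := measure_boostLearner_fail_le hP hk d.succ_pos hh (hPm h hh) (hH.1 h hh) D hm
      (sq_lt_pow_rounds hm) (ENNReal.ofReal e)
    have hcut : iid D m {S | ENNReal.ofReal e < D {x | γ <
        |(boostLearner P γ rounds m (labelled h S) x : ℝ) - (h x : ℝ)|}} ≤ ENNReal.ofReal δ := by
      rcases lt_or_ge e 1 with he1 | he1
      · refine hfail.trans (le_trans (le_of_eq ?_)
          (ENNReal.ofReal_le_ofReal (union_bound_le hd1 hm hδ hδ' he he1)))
        have h0 : (0 : ℝ) ≤ (m : ℝ) ^ (d + 1) * (d + 1 : ℕ) := by positivity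
        rw [ENNReal.ofReal_mul (pow_nonneg h0 _), ENNReal.ofReal_pow (p := 1 - e) (by linarith),
          ENNReal.ofReal_pow h0, ENNReal.ofReal_mul (by positivity),
          ENNReal.ofReal_pow (by positivity), ENNReal.ofReal_natCast, ENNReal.ofReal_natCast,
          ENNReal.ofReal_sub _ he0, ENNReal.ofReal_one]
      · refine le_trans (le_of_eq ?_) (zero_le)
        convert measure_empty (μ := iid D m)
        refine Set.eq_empty_of_forall_notMem fun S hS => ?_
        refine (Set.mem_ofPred_eq ▸ hS : ENNReal.ofReal e < _).not_ge ?_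
        exact prob_le_one.trans (by simpa using ENNReal.ofReal_le_ofReal he1)
    calc _ ≤ iid D m ({S | ¬ AEMeasurable (fun x =>
            |(boostLearner P γ rounds m (labelled h S) x : ℝ) - (h x : ℝ)|) D} ∪ _) := by
          refine measure_mono fun S hS => ?_
          rcases not_and_or.1 hS with h1 | h1
          · exact Or.inl h1
          · exact Or.inr (not_le.1 h1)
      _ ≤ _ := measure_union_le _ _
      _ ≤ ENNReal.ofReal δ := by
          rw [show iid D m {S | ¬ AEMeasurable (fun x =>
            |(boostLearner P γ rounds m (labelled h S) x : ℝ) - (h x : ℝ)|) D} = 0 from hmeas,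
            zero_add]
          exact hcut

lemma sampleComplexity_le {ε δ γ : ℝ} {N : ℕ} (A : Learner X)
    (h : ∀ m, N ≤ m → CutoffSucceeds H A ε δ γ m) : sampleComplexity H ε δ γ ≤ N :=
  (iInf_le _ A).trans (iInf₂_le N h)

/-- The upper bound on the sample complexity. -/
lemma sampleComplexity_le_of_dim_eq (hH : Admissible H) {ε δ γ : ℝ} (hε : 0 < ε) (hε' : ε < 1)
    (hδ : 0 < δ) (hδ' : δ < 1) (hγ : 0 < γ) {d : ℕ} (hd : dim H γ = d) :
    ((sampleComplexity H ε δ γ : ℕ∞) : ℝ≥0∞) ≤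
      ENNReal.ofReal (4 * 10 ^ 10 * ((d : ℝ) / ε * Real.log (2 * (d : ℝ) / ε) ^ 2 +
        1 / ε * Real.log (1 / δ))) := by
  rcases Nat.eq_zero_or_pos d with rfl | hd1
  · have h0 : sampleComplexity H ε δ γ ≤ (0 : ℕ) := by
      rcases H.eq_empty_or_nonempty with rfl | ⟨h₀, hh₀⟩
      · exact sampleComplexity_le (fun _ _ _ => 0) fun m _ h hh => absurd hh (Set.notMem_empty h)
      · refine sampleComplexity_le (fun _ _ => h₀) fun m _ h hh D _ => ?_
        have h2 : {x | γ < |(h₀ x : ℝ) - (h x : ℝ)|} = ∅ := by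
          ext x
          simpa using abs_sub_le_of_dim_eq_zero (by simpa using hd) hh₀ hh x
        simp [CutoffLossLE, h2]
    have h1 : sampleComplexity H ε δ γ = 0 := by simpa using h0
    simp [h1]
  · obtain ⟨A, hA⟩ := exists_learner hH hγ.le hd.le
    set x : ℝ := d / ε * Real.log (2 * d / ε) ^ 2 + 1 / ε * Real.log (1 / δ) with hx
    have hlogδ := log_one_div_nonneg hδ hδ'
    have hd' : (1 : ℝ) ≤ d := by exact_mod_cast hd1
    have hx1 : 1 / 4 ≤ x := by
      have h1 : 1 ≤ d / ε := by rw [le_div_iff₀ hε]; linarith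
      have h2 : 0.69 ≤ Real.log (2 * d / ε) := by
        refine le_trans (by linarith [Real.log_two_gt_d9])
          (Real.log_le_log (by norm_num) (?_ : (2 : ℝ) ≤ _))
        rw [mul_div_assoc]
        linarith
      have h3 : 1 / 4 ≤ Real.log (2 * d / ε) ^ 2 := by nlinarith
      have h4 : 0 ≤ 1 / ε * Real.log (1 / δ) := by positivity
      nlinarith
    have hN : sampleComplexity H ε δ γ ≤ (⌈2 * 10 ^ 10 * x⌉₊ : ℕ) := by
      refine sampleComplexity_le A fun m hm h hh D _ => ?_
      have hm' : 2 * 10 ^ 10 * x ≤ m := Nat.ceil_le.1 hm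
      have hm1 : 1 ≤ m := by
        have : (0 : ℝ) < m := by linarith
        exact_mod_cast this
      refine (measure_mono ?_).trans (hA m hm1 δ hδ hδ' h hh D)
      refine Set.compl_subset_compl.2 fun S hgood => ?_
      exact hgood.2.trans (ENNReal.ofReal_le_ofReal (error_level_le hd1 hε hε' hδ hδ' hm'))
    have hN' : ((sampleComplexity H ε δ γ : ℕ∞) : ℝ≥0∞) ≤
        (((⌈2 * 10 ^ 10 * x⌉₊ : ℕ) : ℕ∞) : ℝ≥0∞) := by exact_mod_cast hN
    refine hN'.trans ?_
    have h1 := (Nat.ceil_lt_add_one (a := 2 * 10 ^ 10 * x) (by linarith)).le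
    rw [ENat.toENNReal_coe, ← ENNReal.ofReal_natCast]
    exact ENNReal.ofReal_le_ofReal (by linarith)

/-! ### The learner adapting to the scale -/

/-- For every `n ≥ 1` some pair of a scale and a bound on its dimension minimizes the trade-off
between scale and estimation error. It depends on `n` and `H` alone, not on the sample. -/
lemma exists_optimal_scale {X : Type u} (H : Set (X → unitInterval)) {n : ℕ} (hn : 1 ≤ n) :
    ∃ γ₀ : ℝ, ∃ d₀ : ℕ, 0 ≤ γ₀ ∧ dim H γ₀ ≤ d₀ ∧ ∀ γ : ℝ, 0 ≤ γ → ∀ d : ℕ, dim H γ ≤ d →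
      γ₀ + 240 * (d₀ * Real.log (n + 1) ^ 2) / n ≤ γ + 240 * (d * Real.log (n + 1) ^ 2) / n := by
  have hn' : (0 : ℝ) < n := by exact_mod_cast hn
  have hL : 1 / 4 ≤ Real.log (n + 1) ^ 2 := by nlinarith [half_le_log_succ hn]
  set L := Real.log (n + 1) ^ 2
  -- `Γ d` is the least scale of dimension at most `d`.
  let Γ : ℕ → ℝ := fun d => sInf {γ | 0 ≤ γ ∧ dim H γ ≤ d}
  have hne : ∀ d : ℕ, {γ | 0 ≤ γ ∧ dim H γ ≤ d}.Nonempty := fun d =>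
    ⟨1, zero_le_one, by simp [dim_one]⟩
  have hbdd : ∀ d : ℕ, BddBelow {γ | 0 ≤ γ ∧ dim H γ ≤ d} := fun d => ⟨0, fun γ h => h.1⟩
  have hΓ0 : ∀ d, 0 ≤ Γ d := fun d => le_csInf (hne d) fun γ h => h.1
  have hΓdim : ∀ d : ℕ, dim H (Γ d) ≤ d := fun d => dim_le_of_forall_gt fun γ' hγ' => by
    obtain ⟨γ, hγ, hlt⟩ := exists_lt_of_csInf_lt (hne d) hγ'
    exact (dim_antitone H hlt.le).trans hγ.2
  have hΓle : ∀ γ : ℝ, 0 ≤ γ → ∀ d : ℕ, dim H γ ≤ d → Γ d ≤ γ := fun γ h0 d hd =>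
    csInf_le (hbdd d) ⟨h0, hd⟩
  -- Dimension bounds above `n` are no better than the scale `1`, whose dimension is `0`.
  obtain ⟨d₀, -, hmin⟩ := Finset.exists_min_image (Finset.range (n + 1))
    (fun d : ℕ => Γ d + 240 * (d * L) / n) ⟨0, by simp⟩
  refine ⟨Γ d₀, d₀, hΓ0 d₀, hΓdim d₀, fun γ hγ d hd => ?_⟩
  rcases lt_or_ge d (n + 1) with hdn | hdn
  · exact (hmin d (Finset.mem_range.2 hdn)).trans (by linarith [hΓle γ hγ d hd])
  · have h0 := hmin 0 (by simp)
    have h1 : Γ 0 ≤ 1 := hΓle 1 zero_le_one 0 (by simp [dim_one])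
    have h2 : 1 ≤ 240 * (d * L) / n := by
      rw [le_div_iff₀ hn']
      have : (n : ℝ) + 1 ≤ d := by exact_mod_cast hdn
      nlinarith
    simp only [Nat.cast_zero, zero_mul, mul_zero, zero_div, add_zero] at h0
    linarith

lemma expLossLE_of_cutoffLossLE {D : Measure X} [IsProbabilityMeasure D] {γ e : ℝ} (hγ : 0 ≤ γ)
    (he : 0 ≤ e) {f h : X → unitInterval} (hm : AEMeasurable (fun x => |(f x : ℝ) - (h x : ℝ)|) D)
    (hcut : CutoffLossLE D γ f h (ENNReal.ofReal e)) :
    ExpLossLE D f h (ENNReal.ofReal (γ + e)) := by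
  refine ⟨hm, ?_⟩
  set E := {x | γ < |(f x : ℝ) - (h x : ℝ)|}
  calc ∫⁻ x, ENNReal.ofReal |(f x : ℝ) - (h x : ℝ)| ∂D
      ≤ ∫⁻ x, (ENNReal.ofReal γ + E.indicator 1 x) ∂D := by
        refine lintegral_mono fun x => ?_
        by_cases hx : x ∈ E
        · have h1 : |(f x : ℝ) - (h x : ℝ)| ≤ 1 := by
            have h2 := (f x).2
            have h3 := (h x).2
            rw [abs_le]
            constructor <;> linarith [h2.1, h2.2, h3.1, h3.2]
          simp only [hx, Set.indicator_of_mem, Pi.one_apply]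
          refine le_add_left ?_
          simpa using ENNReal.ofReal_le_ofReal h1
        · simp only [hx, not_false_eq_true, Set.indicator_of_notMem, add_zero]
          exact ENNReal.ofReal_le_ofReal (not_lt.1 hx)
    _ = ENNReal.ofReal γ + ∫⁻ x, E.indicator 1 x ∂D := by
        rw [lintegral_add_left measurable_const]
        simp
    _ ≤ ENNReal.ofReal γ + D E := by
        gcongr
        exact lintegral_indicator_one_le E
    _ ≤ ENNReal.ofReal (γ + e) := by
        rw [ENNReal.ofReal_add hγ he]
        gcongr
        exact hcut

/-- A single learner attains the optimal trade-off for every sample size: from `n` examples it runs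
the boosted learner at the optimal scale for `n`. -/
lemma exists_adaptive_learner (hH : Admissible H) :
    ∃ A : Learner X, ∀ (n : ℕ) (δ : ℝ), 1 ≤ n → 0 < δ → δ < 1 → ∃ b : ℝ,
      ExpSucceeds H A (ENNReal.ofReal b) δ n ∧ ∀ γ : ℝ, 0 ≤ γ → ∀ d : ℕ, dim H γ ≤ d →
        b ≤ γ + 240 * (d * Real.log (n + 1) ^ 2 + Real.log (1 / δ)) / n := by
  choose! γ₀ d₀ hγ₀ hd₀ hmin using fun (n : ℕ) (hn : 1 ≤ n) => exists_optimal_scale H hn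
  choose! A hA using fun (n : ℕ) (hn : 1 ≤ n) => exists_learner hH (hγ₀ n hn) (hd₀ n hn)
  refine ⟨fun n => A n n, fun n δ hn hδ hδ' => ⟨γ₀ n +
    240 * (d₀ n * Real.log (n + 1) ^ 2 + Real.log (1 / δ)) / n, fun h hh D _ => ?_,
    fun γ hγ d hd => ?_⟩⟩
  · refine (measure_mono ?_).trans (hA n hn n hn δ hδ hδ' h hh D)
    refine Set.compl_subset_compl.2 fun S hgood => ?_
    have := log_one_div_nonneg hδ hδ'
    exact expLossLE_of_cutoffLossLE (hγ₀ n hn) (by positivity) hgood.1 hgood.2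
  · have := hmin n hn γ hγ d hd
    rw [mul_add, mul_add, add_div, add_div]
    linarith

/-! ### Learnability -/

lemma ExpSucceeds.mono {A : Learner X} {b b' : ℝ≥0∞} {δ : ℝ} {n : ℕ}
    (hA : ExpSucceeds H A b δ n) (hb : b ≤ b') : ExpSucceeds H A b' δ n := by
  intro h hh D _
  refine (measure_mono ?_).trans (hA h hh D)
  exact Set.compl_subset_compl.2 fun S hgood => ⟨hgood.1, hgood.2.trans hb⟩

/-- Markov's inequality. -/
lemma ExpSucceeds.cutoffSucceeds {A : Learner X} {ε δ γ : ℝ} {n : ℕ} (hγ : 0 < γ)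
    (hA : ExpSucceeds H A (ENNReal.ofReal (ε * γ)) δ n) : CutoffSucceeds H A ε δ γ n := by
  intro h hh D _
  refine (measure_mono ?_).trans (hA h hh D)
  refine Set.compl_subset_compl.2 fun S hgood => ?_
  have h1 := mul_meas_ge_le_lintegral₀ hgood.1.ennreal_ofReal (ENNReal.ofReal γ)
  have h2 : D {x | γ < |(A n (labelled h S) x : ℝ) - (h x : ℝ)|} * ENNReal.ofReal γ ≤
      ENNReal.ofReal ε * ENNReal.ofReal γ := by
    rw [← ENNReal.ofReal_mul' hγ.le, mul_comm]
    refine le_trans ?_ (h1.trans hgood.2)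
    gcongr
    intro hx
    exact ENNReal.ofReal_le_ofReal (le_of_lt hx)
  exact (ENNReal.mul_le_mul_iff_left (by simpa using hγ) ENNReal.ofReal_ne_top).1 h2

lemma PACLearnable.cutoffPACLearnable (hH : PACLearnable H) : CutoffPACLearnable H := by
  obtain ⟨A, hA⟩ := hH
  refine ⟨A, fun ε δ γ hε hε' hδ hδ' hγ hγ' => ?_⟩
  obtain ⟨n, hn⟩ := hA (ε * γ) δ (by positivity) (by nlinarith) hδ hδ'
  exact ⟨n, hn.cutoffSucceeds hγ⟩

lemma CutoffPACLearnable.dim_lt_top (hH : CutoffPACLearnable H) {γ : ℝ} (hγ : 0 < γ)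
    (hγ' : γ < 1) : dim H γ < ⊤ := by
  obtain ⟨A, hA⟩ := hH
  obtain ⟨m, hm⟩ := hA (1 / 48) (1 / 10) (γ / 2) (by norm_num) (by norm_num) (by norm_num)
    (by norm_num) (by linarith) (by linarith)
  by_contra htop
  obtain ⟨n, hn, S, V, hVf, hV, hσ⟩ := exists_witness_of_lt_dim (H := H) (γ := γ) (k := 4 * m + 1)
    (by rw [not_lt_top_iff.1 htop]; exact ENat.natCast_lt_top _)
  rw [show γ = 2 * (γ / 2) by ring] at hσ
  refine not_cutoffSucceeds_of_witness H (by omega) S V hVf hV (by linarith) hσ (by norm_num)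
    le_rfl (by norm_num) A ?_ hm
  have : ((4 * m + 1 : ℕ) : ℝ) < n := by exact_mod_cast hn
  push_cast at this
  linarith

lemma pacLearnable_of_dim_lt_top (hH : Admissible H)
    (hd : ∀ γ : ℝ, 0 < γ → γ < 1 → dim H γ < ⊤) : PACLearnable H := by
  obtain ⟨A, hA⟩ := exists_adaptive_learner hH
  refine ⟨A, fun ε δ hε hε' hδ hδ' => ?_⟩
  obtain ⟨d, hdd⟩ := ENat.ne_top_iff_exists.1 (hd (ε / 2) (by linarith) (by linarith)).ne
  set x : ℝ := 2 * 10 ^ 10 * ((d + 1 : ℕ) / (ε / 2) * Real.log (2 * (d + 1 : ℕ) / (ε / 2)) ^ 2 +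
    1 / (ε / 2) * Real.log (1 / δ))
  have hn : x ≤ ((⌈x⌉₊ + 1 : ℕ) : ℝ) := by
    push_cast
    linarith [Nat.le_ceil x]
  obtain ⟨b, hb, hbmin⟩ := hA (⌈x⌉₊ + 1) δ (by omega) hδ hδ'
  refine ⟨⌈x⌉₊ + 1, hb.mono (ENNReal.ofReal_le_ofReal ?_)⟩
  have h1 := hbmin (ε / 2) (by linarith) (d + 1) (by rw [← hdd]; exact_mod_cast Nat.le_succ d)
  have h2 := error_level_le (d := d + 1) (by omega) (by linarith) (by linarith) hδ hδ' hn
  linarith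

/-- The lower bound on the sample complexity. -/
lemma dim_le_sampleComplexity (H : Set (X → unitInterval)) {ε δ γ : ℝ} (hε : 0 < ε)
    (hε' : ε ≤ 1 / 48) (hδ : δ < 1 / 8) (hγ : 0 < γ) (hdim : 2 ≤ dim H (2 * γ)) :
    ENNReal.ofReal (1 / 192 / ε) * ((dim H (2 * γ) : ℕ∞) : ℝ≥0∞) ≤
      ((sampleComplexity H ε δ γ : ℕ∞) : ℝ≥0∞) := by
  have hfail : ∀ k : ℕ, 1 ≤ k → (k : ℕ∞) < dim H (2 * γ) → ∀ m : ℕ,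
      (m : ℝ) * (192 * ε) ≤ (k + 1 : ℕ) → (m + 1 : ℕ) ≤ sampleComplexity H ε δ γ := by
    intro k hk hkd m hm
    obtain ⟨n, hn, S, V, hVf, hV, hσ⟩ := exists_witness_of_lt_dim hkd
    refine le_iInf fun A => le_iInf₂ fun N hN => ?_
    by_contra! hlt
    have hNm : N ≤ m := by
      have : N < m + 1 := by exact_mod_cast hlt
      omega
    exact not_cutoffSucceeds_of_witness H (by omega) S V hVf hV hγ hσ hε hε' hδ A
      (hm.trans (by exact_mod_cast hn)) (hN m hNm)
  rcases eq_or_ne (dim H (2 * γ)) ⊤ with htop | htop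
  · have hM : sampleComplexity H ε δ γ = ⊤ := by
      refine ENat.eq_top_iff_forall_ge.2 fun m => ?_
      obtain ⟨k, hk⟩ := exists_nat_ge ((m : ℝ) * (192 * ε))
      refine le_trans ?_ (hfail (k + 1) (by omega) (by rw [htop]; exact ENat.natCast_lt_top _) m
        (hk.trans (by push_cast; linarith)))
      exact_mod_cast Nat.le_succ m
    simp [hM]
  · obtain ⟨d, hd⟩ := ENat.ne_top_iff_exists.1 htop
    rw [← hd] at hdim hfail ⊢
    have hd2 : 2 ≤ d := by exact_mod_cast hdim
    set m := ⌊(d : ℝ) / (192 * ε)⌋₊ with hm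
    have h1 : (m : ℝ) * (192 * ε) ≤ d := by
      rw [← le_div_iff₀ (by positivity)]
      exact Nat.floor_le (by positivity)
    have h2 := hfail (d - 1) (by omega) (by exact_mod_cast (by omega : d - 1 < d)) m
      (h1.trans (by rw [Nat.sub_add_cancel (by omega)]))
    have h3 : (((m + 1 : ℕ) : ℕ∞) : ℝ≥0∞) ≤ ((sampleComplexity H ε δ γ : ℕ∞) : ℝ≥0∞) := by
      exact_mod_cast h2
    refine le_trans ?_ h3
    rw [ENat.toENNReal_coe, ENat.toENNReal_coe, ← ENNReal.ofReal_natCast d,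
      ← ENNReal.ofReal_mul (by positivity), ← ENNReal.ofReal_natCast (m + 1)]
    refine ENNReal.ofReal_le_ofReal ?_
    have h4 := (Nat.lt_floor_add_one ((d : ℝ) / (192 * ε))).le
    push_cast
    refine le_trans (le_of_eq ?_) h4
    field_simp

end UpperBound

end OIG

theorem mainTheorem2 :
    -- lower bound
    (∃ c : ℝ, 0 < c ∧ ∀ (X : Type u) [MeasurableSpace X] (H : Set (X → unitInterval)) (ε δ γ : ℝ),
      0 < ε → ε ≤ c → 0 < δ → δ ≤ c → 0 < γ → γ < 1 → 2 ≤ OIG.dim H (2 * γ) →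
        ENNReal.ofReal (c / ε) * ((OIG.dim H (2 * γ) : ℕ∞) : ℝ≥0∞) ≤
          ((OIG.sampleComplexity H ε δ γ : ℕ∞) : ℝ≥0∞)) ∧
    -- upper bounds
    (∃ C : ℝ, 0 < C ∧ ∀ (X : Type u) [MeasurableSpace X] (H : Set (X → unitInterval)),
      OIG.Admissible H →
        (∀ ε δ γ : ℝ, 0 < ε → ε < 1 → 0 < δ → δ < 1 → 0 < γ → γ < 1 →
          ∀ d : ℕ, OIG.dim H γ = (d : ℕ∞) →
            ((OIG.sampleComplexity H ε δ γ : ℕ∞) : ℝ≥0∞) ≤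
              ENNReal.ofReal (C * ((d : ℝ) / ε * Real.log (2 * (d : ℝ) / ε) ^ 2 +
                1 / ε * Real.log (1 / δ)))) ∧
        ∃ A : OIG.Learner X, ∀ (n : ℕ) (δ : ℝ), 1 ≤ n → 0 < δ → δ < 1 →
          OIG.ExpSucceeds H A
            (⨅ γ ∈ Set.Icc (0 : ℝ) 1, ENNReal.ofReal γ + ENNReal.ofReal (C / (n : ℝ)) *
              (((OIG.dim H γ : ℕ∞) : ℝ≥0∞) * ENNReal.ofReal (Real.log ((n : ℝ) + 1) ^ 2) +
                ENNReal.ofReal (Real.log (1 / δ)))) δ n) ∧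
    -- qualitative characterization
    (∀ (X : Type u) [MeasurableSpace X] (H : Set (X → unitInterval)), OIG.Admissible H →
      (OIG.PACLearnable H ↔ ∀ γ : ℝ, 0 < γ → γ < 1 → OIG.dim H γ < ⊤) ∧
      (OIG.CutoffPACLearnable H ↔ ∀ γ : ℝ, 0 < γ → γ < 1 → OIG.dim H γ < ⊤)) := by
  refine ⟨⟨1 / 192, by norm_num, fun X _ H ε δ γ hε hε' _ hδ hγ _ hdim =>
      OIG.dim_le_sampleComplexity H hε (by linarith) (by linarith) hγ hdim⟩,
    ⟨4 * 10 ^ 10, by norm_num, fun X _ H hH => ⟨fun ε δ γ hε hε' hδ hδ' hγ _ d hd =>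
      OIG.sampleComplexity_le_of_dim_eq hH hε hε' hδ hδ' hγ hd, ?_⟩⟩,
    fun X _ H hH => ⟨⟨fun h γ hγ hγ' => h.cutoffPACLearnable.dim_lt_top hγ hγ',
      OIG.pacLearnable_of_dim_lt_top hH⟩, ⟨fun h γ hγ hγ' => h.dim_lt_top hγ hγ',
      fun h => (OIG.pacLearnable_of_dim_lt_top hH h).cutoffPACLearnable⟩⟩⟩
  obtain ⟨A, hA⟩ := OIG.exists_adaptive_learner hH
  refine ⟨A, fun n δ hn hδ hδ' => ?_⟩
  obtain ⟨b, hb, hbmin⟩ := hA n δ hn hδ hδ'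
  refine hb.mono (le_iInf₂ fun γ hγ => ?_)
  have hn' : (0 : ℝ) < n := by exact_mod_cast hn
  have hlogδ := OIG.log_one_div_nonneg hδ hδ'
  have hL : 0 < Real.log ((n : ℝ) + 1) ^ 2 := pow_pos (Real.log_pos (by linarith)) 2
  rcases eq_or_ne (OIG.dim H γ) ⊤ with htop | htop
  · have hC : ENNReal.ofReal (4 * 10 ^ 10 / (n : ℝ)) ≠ 0 := by
      simp only [ne_eq, ENNReal.ofReal_eq_zero, not_le]
      positivity
    have hL' : ENNReal.ofReal (Real.log ((n : ℝ) + 1) ^ 2) ≠ 0 := by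
      simpa only [ne_eq, ENNReal.ofReal_eq_zero, not_le] using hL
    rw [htop, ENat.toENNReal_top, ENNReal.top_mul hL', top_add, ENNReal.mul_top hC, add_top]
    exact le_top
  · obtain ⟨d, hd⟩ := ENat.ne_top_iff_exists.1 htop
    rw [← hd, ENat.toENNReal_coe, ← ENNReal.ofReal_natCast,
      ← ENNReal.ofReal_mul (Nat.cast_nonneg d), ← ENNReal.ofReal_add (by positivity) hlogδ,
      ← ENNReal.ofReal_mul (by positivity), ← ENNReal.ofReal_add hγ.1 (by positivity)]
    refine ENNReal.ofReal_le_ofReal ((hbmin γ hγ.1 d hd.ge).trans ?_)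
    rw [mul_div_right_comm]
    gcongr
    norm_num
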